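/- **Notation.** Write $e(x)=e^{2\pi i x}$. For integers $r,s\ge 2$ write $r\sim s$ if $r^k=s^l$ for some positive integers $k,l$. For strings $z,w$ over $\{0,\dots,b-1\}$ let $N(z,w)$ be the number of (possibly overlapping) occurrences of $z$ in $w$, and let $w_1^n$ be the prefix of $w$ of length $n$. *Low discrepancy strings.* For each base $b$ let $C_b$ be a real constant and $N_b$ a threshold for it: for every $n'>N_b$, all but at most $\frac12 b^{n'}$ of the strings $w$ of length $n'$ over $\{0,\dots,b-1\}$ satisfy $$\Bigl|\frac{N(z,w_1^n)}{n}-b^{-|z|}\Bigr|<C_b\frac{\sqrt{\log\log n}}{\sqrt n}\qquad\text{for all strings } z \text{ with } |z|\le n'-N_b \text{ and all } N_b\le n\le n'-|z|.\tag{1}$$ (Put $N_b=\infty$ if there is no such number for $C_b$.) Let $\mathcal G_b^{n'}$ be the set of strings of length $n'$ over $\{0,\dots,b-1\}$ that satisfy (1). *The sequences.* Let $u(1),u(2),\dots$ be integers $\ge 2$ and let $p:\mathbb N\to\mathbb N$ satisfy $1\le p(u(m))\le u(m)$ for all $m\ge1$. For $m \geq 1$ put $\langle m\rangle=\lceil e^{\sqrt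 m}+2u(1)m^3\rceil$, $\langle m;r\rangle=\lceil\langle m\rangle/\log r\rceil$, $a_m=\langle m;u(m)\rangle$, $b_m=\langle m+1;u(m)\rangle$. Let $f_n(x)=\bigl|\frac{\sin(n\pi x)}{n\sin(\pi x)}\bigr|$, extended continuously by $f_n(x)=1$ for $x\in\mathbb Z$. For bases $r\not\sim s$ let $\alpha(r,s)=\alpha(s,r)$ be the largest $a\in[0,\frac12]$ such that $$\sum_{n=0}^{M-1}\prod_{i=K+1}^{\infty}f_{p(s)}\bigl(r^n\ell/s^i\bigr)\le 2M^{1-a}\qquad\text{for all natural numbers } M,K,\ell\text{ with }\ell\ge s^K,$$ and the same holds with $r$ and $s$ interchanged. Let $$\beta_m=\min\bigl(\{\alpha(u(i),u(j)):1\le i\le j\le m,\ u(i)\not\sim u(j)\}\cup\{\tfrac12\}\bigr).$$ The sequence $u$ is *good* if 1. $\prod_{i=b_m-1}^{\infty} f_{p(u(m))}(2^{-(i+1)})\ge\prod_{i=1}^{\infty}|\cos(\pi/2^{i+1})|$ for every $m>1$; 2. $\beta_m\ge\beta_1 m^{-1/4}$ for every $m\ge1$; 3. $u(m)\le u(1)\,m$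 for every $m\ge1$; 4. for every $m\ge1$, if $u(m')\ne u(m)$ for some $1\le m'<m$, then $b_m-a_m\ge\max\{N_{u(m)},N_{p(u(m))}\}$. *The choice of $\xi_m$.* Let $$A_m(x)=\sum_{\substack{t=-m\\t\ne0}}^{m}\ \sum_{\substack{h=1\\u(h)\not\sim u(m)}}^{m}\Bigl|\sum_{j=\langle m;u(h)\rangle+1}^{\langle m+1;u(h)\rangle}e\bigl(u(h)^{j-1}tx\bigr)\Bigr|^2 .$$ For $\lambda\ge0$ let $\eta_m(\lambda)=g\,u(m)^{-a_m}$ with $g$ the least non-negative integer such that $g\,u(m)^{-a_m}\ge\lambda$. For $q\le u(m)$ let $\Sigma_m^q(\lambda)$ be the set of numbers $\eta_m(\lambda)+\sum_{i=a_m+1}^{b_m-2}c_iu(m)^{-i}$ with digits $c_i\in\{0,\dots,q-1\}$ whose digit string $c_{a_m+1}\cdots c_{b_m-2}$ lies in $\mathcal G_q^{\,b_m-a_m-2}$. *Criterion 1* at step $m$: $\xi_m$ is an element of $\Sigma_m^{p(u(m))}(\xi_{m-1})$ at which $A_m$ is minimal on that set. *Criterion 2*: the same with $\Sigma_m^{u(m)}(\xi_{m-1})$.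 **Lemma.** Let $u$ be a good sequence of bases $\ge2$, let $\xi_0=0$, and let each $\xi_m$ ($m\ge1$) be chosen according to Criterion 1 or Criterion 2 (the criterion may vary with $m$). Then $\xi_m$ converges to a real number $\xi$, and there is a constant $\delta$ depending only on $u(1)$ such that for every $m\ge1$ $$A_m(\xi)\le\delta\,m^2\,(\langle m+1\rangle-\langle m\rangle)^{2-\beta_m}.$$ -/

import Mathlib

noncomputable section

namespace SchmidtConstruction

/-- Multiplicative equivalence of bases: `r ~ s` iff `r ^ m = s ^ n` for some positive `m`, `n`. -/
def BaseEquiv (r s : ℕ) : Prop :=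
  ∃ m n : ℕ, 0 < m ∧ 0 < n ∧ r ^ m = s ^ n

/-- `e(x) = exp (2 π i x)`. -/
def e (x : ℝ) : ℂ :=
  Complex.exp (2 * Real.pi * Complex.I * x)

/-! ### Low discrepancy strings -/

/-- `N(z, w)`: the number of (sliding) occurrences of the string `z` in the string `w`. -/
def occurrenceCount {b : ℕ} (z w : List (Fin b)) : ℕ :=
  ((Finset.range (w.length + 1 - z.length)).filter
    fun i => (w.drop i).take z.length = z).card

/-- The string `w` over `{0, …, b - 1}` has low discrepancy with constant `C` and threshold `N`:
for every string `z` of length at most `|w| - N` and all `n` with `N ≤ n ≤ |w| - |z|`,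
`|N(z, w₁ … wₙ) / n - b ^ (-|z|)| < C √(log log n) / √n`. -/
def IsLowDiscrepancy {b : ℕ} (C : ℝ) (N : ℕ∞) (w : List (Fin b)) : Prop :=
  ∀ (z : List (Fin b)) (n : ℕ),
    (z.length : ℕ∞) + N ≤ w.length → N ≤ n → n + z.length ≤ w.length →
      |(occurrenceCount z (w.take n) : ℝ) / n - 1 / (b : ℝ) ^ z.length|
        < C * (Real.sqrt (Real.log (Real.log n)) / Real.sqrt n)

/-- For every length `n' > N`, all but at most `ε b ^ n'` of the strings of length `n'` over
`{0, …, b - 1}` have low discrepancy with constant `C` and threshold `N`. -/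
def IsThreshold (b : ℕ) (C ε : ℝ) (N : ℕ) : Prop :=
  ∀ n' : ℕ, N < n' →
    (({w : Fin n' → Fin b | ¬ IsLowDiscrepancy C N (List.ofFn w)}.ncard : ℕ) : ℝ)
      ≤ ε * (b : ℝ) ^ n'

/-- The least threshold belonging to the base `b`, the constant `C` and the exceptional
proportion `ε`; it is `⊤` if there is none. `IsThreshold b C ε` is monotone in `N`, so the
thresholds are exactly the natural numbers that are at least this one. -/
def leastThreshold (b : ℕ) (C ε : ℝ) : ℕ∞ :=
  ⨅ (N : ℕ) (_ : IsThreshold b C ε N), (N : ℕ∞)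

/-! ### The exponents `α(r, s)` -/

/-- The continuous extension to all real `x` of `|sin (n π x) / (n sin (π x))|`
(its value at the integers is `1`). -/
def sineRatio (n : ℕ) (x : ℝ) : ℝ :=
  open Classical in
  if Real.sin (Real.pi * x) = 0 then 1
  else |Real.sin (n * Real.pi * x) / (n * Real.sin (Real.pi * x))|

/-- The sine product bound with exponent `a` for the pair of bases `(r, s)`: for all `N`, `K`
and all `ℓ ≥ s ^ K`,
`∑_{n < N} ∏_{i > K} |sin (p(s) π r ^ n ℓ / s ^ i) / (p(s) sin (π r ^ n ℓ / s ^ i))| ≤ 2 N ^ (1 - a)`.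
All factors lie in `[0, 1]`, so the infinite products converge. -/
def SineBound (p : ℕ → ℕ) (r s : ℕ) (a : ℝ) : Prop :=
  ∀ N K l : ℕ, s ^ K ≤ l →
    ∑ n ∈ Finset.range N,
        ∏' i : ℕ, sineRatio (p s) ((r : ℝ) ^ n * l / (s : ℝ) ^ (K + 1 + i))
      ≤ 2 * (N : ℝ) ^ (1 - a)

/-- `α(r, s)`: the largest exponent in `[0, 1/2]` with which the sine product bound holds for
both `(r, s)` and `(s, r)`; it is symmetric in `r` and `s`. A smaller choice of the exponents
makes the notion of a good sequence more restrictive and the bound on `A_m` weaker. -/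
def alpha (p : ℕ → ℕ) (r s : ℕ) : ℝ :=
  sSup {a : ℝ | 0 ≤ a ∧ a ≤ 1 / 2 ∧ SineBound p r s a ∧ SineBound p s r a}

/-! ### The step lengths. Sequences `u(1), u(2), …` are functions `u : ℕ → ℕ`; `u 0` is not used. -/

/-- `⟨m⟩ = ⌈e ^ √m + 2 u(1) m ^ 3⌉` for `m ≥ 1`, and `⟨0⟩ = 0`. -/
def angle (u : ℕ → ℕ) (m : ℕ) : ℕ :=
  if m = 0 then 0 else ⌈Real.exp (Real.sqrt m) + 2 * (u 1 : ℝ) * (m : ℝ) ^ 3⌉₊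

/-- `⟨m; r⟩ = ⌈⟨m⟩ / log r⌉`. -/
def angleBase (u : ℕ → ℕ) (m r : ℕ) : ℕ :=
  ⌈(angle u m : ℝ) / Real.log r⌉₊

/-- `a_m = ⟨m; u(m)⟩`. -/
def aIdx (u : ℕ → ℕ) (m : ℕ) : ℕ := angleBase u m (u m)

/-- `b_m = ⟨m + 1; u(m)⟩`. -/
def bIdx (u : ℕ → ℕ) (m : ℕ) : ℕ := angleBase u (m + 1) (u m)

/-- `β_m = min ({α(u(i), u(j)) : 1 ≤ i ≤ j ≤ m, u(i) ≁ u(j)} ∪ {1/2})`. -/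
def beta (p u : ℕ → ℕ) (m : ℕ) : ℝ :=
  sInf ({x : ℝ | ∃ i j : ℕ, 1 ≤ i ∧ i ≤ j ∧ j ≤ m ∧ ¬ BaseEquiv (u i) (u j) ∧
    x = alpha p (u i) (u j)} ∪ {1 / 2})

/-- Good sequences, relative to `p` and to the thresholds `N b` (standing for `N_b(1/2)`). -/
structure IsGoodSequence (p : ℕ → ℕ) (N : ℕ → ℕ∞) (u : ℕ → ℕ) : Prop where
  prod_ge : ∀ m : ℕ, 1 < m →
    ∏' i : ℕ, |Real.cos (Real.pi / 2 ^ ((1 + i) + 1))|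
      ≤ ∏' i : ℕ, sineRatio (p (u m)) (1 / 2 ^ ((bIdx u m - 1 + i) + 1))
  beta_ge : ∀ m : ℕ, 1 ≤ m → beta p u 1 * (1 / (m : ℝ) ^ (1 / 4 : ℝ)) ≤ beta p u m
  le_mul : ∀ m : ℕ, 1 ≤ m → u m ≤ u 1 * m
  threshold_le : ∀ m : ℕ, 1 ≤ m → (∃ m' : ℕ, 1 ≤ m' ∧ m' < m ∧ u m' ≠ u m) →
    max (N (u m)) (N (p (u m))) ≤ ((bIdx u m - aIdx u m : ℕ) : ℕ∞)

/-! ### The choice of `ξ_m` -/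

/-- `A_m(x) = ∑_{0 < |t| ≤ m} ∑_{1 ≤ h ≤ m, u(h) ≁ u(m)}
  |∑_{⟨m; u(h)⟩ < j ≤ ⟨m + 1; u(h)⟩} e(u(h) ^ (j - 1) t x)| ^ 2`. -/
def A (u : ℕ → ℕ) (m : ℕ) (x : ℝ) : ℝ :=
  open Classical in
  ∑ t ∈ (Finset.Icc (-(m : ℤ)) m).filter (fun t => t ≠ 0),
    ∑ h ∈ (Finset.Icc 1 m).filter (fun h => ¬ BaseEquiv (u h) (u m)),
      ‖∑ j ∈ Finset.Icc (angleBase u m (u h) + 1) (angleBase u (m + 1) (u h)),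
        e ((u h : ℝ) ^ (j - 1) * t * x)‖ ^ 2

/-- `η_m(y) = g u(m) ^ (-a_m)`, where `g` is the least natural number with
`g u(m) ^ (-a_m) ≥ y`. -/
def eta (u : ℕ → ℕ) (m : ℕ) (y : ℝ) : ℝ :=
  (⌈y * (u m : ℝ) ^ aIdx u m⌉₊ : ℝ) / (u m : ℝ) ^ aIdx u m

/-- The number `η_m(y) + ∑_{i = a_m + 1}^{b_m - 2} c_i u(m) ^ (-i)` with digits `c_i` from
`{0, …, q - 1}`; the digit `c_{a_m + 1 + k}` is `c k`. For `q = u(m)` these numbers form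
`σ_m(y)`, for `q = p(u(m))` they form `σ*_m(y)`. -/
def sigmaPoint (u : ℕ → ℕ) (m : ℕ) (y : ℝ) (q : ℕ)
    (c : Fin (bIdx u m - aIdx u m - 2) → Fin q) : ℝ :=
  eta u m y + ∑ k, ((c k : ℕ) : ℝ) / (u m : ℝ) ^ (aIdx u m + 1 + (k : ℕ))

/-- `x` is a point of `σ_m(y)` (for `q = u(m)`) or of `σ*_m(y)` (for `q = p(u(m))`) whose digit
string has low discrepancy in base `q`, and `A_m(x)` is minimal among all such points. -/
def IsMinimalChoice (u : ℕ → ℕ) (C : ℕ → ℝ) (N : ℕ → ℕ∞) (m : ℕ) (y : ℝ) (q : ℕ) (x : ℝ) :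
    Prop :=
  ∃ c : Fin (bIdx u m - aIdx u m - 2) → Fin q,
    IsLowDiscrepancy (C q) (N q) (List.ofFn c) ∧ x = sigmaPoint u m y q c ∧
    ∀ c' : Fin (bIdx u m - aIdx u m - 2) → Fin q,
      IsLowDiscrepancy (C q) (N q) (List.ofFn c') → A u m x ≤ A u m (sigmaPoint u m y q c')

/-- Criterion 1: the digits are restricted to the `p(u(m))` symbols `0, …, p(u(m)) - 1`. -/
def Criterion1 (p u : ℕ → ℕ) (C : ℕ → ℝ) (N : ℕ → ℕ∞) (m : ℕ) (y x : ℝ) : Prop :=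
  IsMinimalChoice u C N m y (p (u m)) x

/-- Criterion 2: all digits `0, …, u(m) - 1` are allowed. -/
def Criterion2 (u : ℕ → ℕ) (C : ℕ → ℝ) (N : ℕ → ℕ∞) (m : ℕ) (y x : ℝ) : Prop :=
  IsMinimalChoice u C N m y (u m) x

end SchmidtConstruction

end

namespace SchmidtConstruction

/-! ### Exponential sums and sine ratios -/

/-! The minimum of `A` over the admissible digit strings is compared with its mean over all strings
in `{0, …, q - 1}^n`. At least half of the strings have low discrepancy, so the minimum is at most
twice that mean (`IsMinimalChoice.A_mul_le`). For one pair `(t, h)`, with `r = u h` and `s = u m`,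
the square is opened and summed over the digits. The digits are independent, so each pair of
exponents contributes `q ^ n` times a finite product of sine ratios (`norm_sum_e_digits`). Pairs
with a fixed difference `d` have frequency differences `r ^ x * l` with `l ≥ s ^ a`, and these are
the sums governed by `SineBound`. The finite product costs a factor 2 against the infinite one as
long as the frequency is well below `s ^ (a + 1 + n)`. Differences below `cutoff u m`, and that many
terms at the end of each diagonal, are bounded trivially (`sum_diagonal_le`, `mean_square_le`). The
cutoff is linear in `m` because `u m ≤ u 1 * m`. The cubic term of `angle` makes `D = ⟨m + 1⟩ - ⟨m⟩`
at least `m ^ 2`, so the trivial part is `O(m D)`, hence `O(D ^ (2 - β))` since `β ≤ 1/2`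
(`length_bound_le`). For Criterion 1 the sine bound comes from the definition of `β`. For Criterion
2 the products telescope and decay geometrically (`sineBound_full`). Finally the limit lies within
`4 e ^ (-⟨m + 1⟩)` of `ξ m`, which moves each inner sum by only `O(m)` (`A_le_two_mul_A_add`). -/

theorem e_add (x y : ℝ) : e (x + y) = e x * e y := by
  simp only [e, ← Complex.exp_add]
  congr 1
  push_cast
  ring

theorem e_nat_mul (n : ℕ) (x : ℝ) : e (n * x) = e x ^ n := by
  simp only [e, ← Complex.exp_nat_mul]
  congr 1
  push_cast
  ring

theorem e_eq_exp_I_mul (x : ℝ) : e x = Complex.exp (Complex.I * ((2 * Real.pi * x : ℝ) : ℂ)) := by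
  rw [e]
  congr 1
  push_cast
  ring

theorem norm_e (x : ℝ) : ‖e x‖ = 1 := by
  rw [e_eq_exp_I_mul, mul_comm, Complex.norm_exp_ofReal_mul_I]

theorem norm_e_sub_one (x : ℝ) : ‖e x - 1‖ = 2 * |Real.sin (Real.pi * x)| := by
  rw [e_eq_exp_I_mul, Complex.norm_exp_I_mul_ofReal_sub_one, Real.norm_eq_abs, abs_mul,
    abs_two]
  congr 3
  ring

theorem conj_e (x : ℝ) : (starRingEnd ℂ) (e x) = e (-x) := by
  rw [e, e, ← Complex.exp_conj]
  congr 1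
  simp [Complex.conj_ofReal, map_ofNat]

theorem e_finset_sum {ι : Type*} (s : Finset ι) (f : ι → ℝ) :
    e (∑ i ∈ s, f i) = ∏ i ∈ s, e (f i) := by
  simp only [e, ← Complex.exp_sum]
  congr 1
  push_cast
  rw [Finset.mul_sum]

theorem norm_e_sub_e_le (x y : ℝ) : ‖e x - e y‖ ≤ 2 * Real.pi * |x - y| := by
  have h : e x - e y = e y * (e (x - y) - 1) := by
    rw [mul_sub, ← e_add, mul_one]
    congr 2
    ring
  rw [h, norm_mul, norm_e, one_mul, norm_e_sub_one]
  have h1 : |Real.sin (Real.pi * (x - y))| ≤ Real.pi * |x - y| := by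
    refine (Real.abs_sin_le_abs).trans ?_
    rw [abs_mul, abs_of_pos Real.pi_pos]
  linarith

theorem sin_nat_mul_eq_zero {x : ℝ} (n : ℕ) (h : Real.sin (Real.pi * x) = 0) :
    Real.sin (n * Real.pi * x) = 0 := by
  obtain ⟨k, hk⟩ := Real.sin_eq_zero_iff.1 h
  refine Real.sin_eq_zero_iff.2 ⟨n * k, ?_⟩
  push_cast
  rw [mul_assoc, hk]
  ring

theorem sineRatio_mul (n : ℕ) (hn : n ≠ 0) (x : ℝ) :
    sineRatio n x * (n * |Real.sin (Real.pi * x)|) = |Real.sin (n * Real.pi * x)| := by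
  rw [sineRatio]
  split_ifs with h
  · rw [h, sin_nat_mul_eq_zero n h]
    simp
  · rw [abs_div, abs_mul, Nat.abs_cast]
    have : (n : ℝ) ≠ 0 := by exact_mod_cast hn
    have := abs_ne_zero.2 h
    field_simp

theorem norm_sum_e_eq (q : ℕ) (hq : q ≠ 0) (x : ℝ) :
    ‖∑ c ∈ Finset.range q, e (c * x)‖ = q * sineRatio q x := by
  simp only [e_nat_mul]
  by_cases h : Real.sin (Real.pi * x) = 0
  · have h1 : e x = 1 := by
      rw [← sub_eq_zero, ← norm_eq_zero, norm_e_sub_one, h]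
      simp
    simp [h1, sineRatio, h]
  · have h2 := congrArg norm (geom_sum_mul (e x) q)
    rw [← e_nat_mul, norm_mul, norm_e_sub_one, norm_e_sub_one] at h2
    have h3 := sineRatio_mul q hq x
    rw [show Real.pi * (q * x) = q * Real.pi * x by ring, ← h3] at h2
    have h4 : (0 : ℝ) < |Real.sin (Real.pi * x)| := abs_pos.2 h
    refine mul_right_cancel₀ (ne_of_gt (mul_pos two_pos h4)) ?_
    rw [h2]
    ring

theorem sineRatio_nonneg (n : ℕ) (x : ℝ) : 0 ≤ sineRatio n x := by
  rw [sineRatio]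
  split_ifs
  · exact zero_le_one
  · exact abs_nonneg _

theorem sineRatio_le_one (n : ℕ) (x : ℝ) : sineRatio n x ≤ 1 := by
  rcases eq_or_ne n 0 with rfl | hn
  · rw [sineRatio]
    split_ifs <;> simp
  · have h := norm_sum_le (Finset.range n) (fun c : ℕ => e (c * x))
    rw [norm_sum_e_eq n hn] at h
    simp only [norm_e, Finset.sum_const, Finset.card_range, nsmul_eq_mul, mul_one] at h
    have hn' : (0 : ℝ) < n := by exact_mod_cast Nat.pos_of_ne_zero hn
    nlinarith

theorem sineRatio_neg (n : ℕ) (x : ℝ) : sineRatio n (-x) = sineRatio n x := by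
  simp [sineRatio]

theorem prod_sineRatio_nonneg (q : ℕ) (n : ℕ) (x : ℕ → ℝ) :
    0 ≤ ∏ i ∈ Finset.range n, sineRatio q (x i) :=
  Finset.prod_nonneg fun _ _ => sineRatio_nonneg _ _

theorem prod_sineRatio_le_one (q : ℕ) (n : ℕ) (x : ℕ → ℝ) :
    ∏ i ∈ Finset.range n, sineRatio q (x i) ≤ 1 :=
  Finset.prod_le_one (fun _ _ => sineRatio_nonneg _ _) fun _ _ => sineRatio_le_one _ _

/-! ### Infinite products of factors in `[0, 1]` -/

/-- Finite products of such factors decrease along inclusion and are bounded below, so the product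
converges unconditionally, possibly to 0. -/
theorem tendsto_prod_range_tprod {f : ℕ → ℝ} (h0 : ∀ i, 0 ≤ f i) (h1 : ∀ i, f i ≤ 1) :
    Filter.Tendsto (fun n => ∏ i ∈ Finset.range n, f i) Filter.atTop (nhds (∏' i, f i)) := by
  have hanti : Antitone fun s : Finset ℕ => ∏ i ∈ s, f i := fun s t hst =>
    Finset.prod_le_prod_of_subset_of_le_one hst (fun i _ => h0 i) fun i _ _ => h1 i
  have hbdd : BddBelow (Set.range fun s : Finset ℕ => ∏ i ∈ s, f i) :=
    ⟨0, by rintro _ ⟨s, rfl⟩; exact Finset.prod_nonneg fun i _ => h0 i⟩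
  have hm : Multipliable f := ⟨_, tendsto_atTop_ciInf hanti hbdd⟩
  exact hm.hasProd.tendsto_prod_nat

theorem tprod_sineRatio_le_prod (q : ℕ) (x : ℕ → ℝ) (n : ℕ) :
    ∏' i, sineRatio q (x i) ≤ ∏ i ∈ Finset.range n, sineRatio q (x i) := by
  refine le_of_tendsto (tendsto_prod_range_tprod (fun i => sineRatio_nonneg q (x i))
    fun i => sineRatio_le_one q (x i)) ?_
  filter_upwards [Filter.eventually_ge_atTop n] with k hk
  exact Finset.prod_le_prod_of_subset_of_le_one (Finset.range_mono hk)
    (fun i _ => sineRatio_nonneg _ _) fun i _ _ => sineRatio_le_one _ _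

theorem tprod_sineRatio_le_one (q : ℕ) (x : ℕ → ℝ) : ∏' i, sineRatio q (x i) ≤ 1 := by
  simpa using tprod_sineRatio_le_prod q x 0

/-- With `z = q π x ≤ 1`, the numerator is at least `z - z ^ 3 / 4` and the denominator at most `z`.
Then `π ^ 2 ≤ 16` is used. -/
theorem one_sub_sq_le_sineRatio {q : ℕ} (hq : q ≠ 0) {x : ℝ} (hx : 0 ≤ x) (hqx : q * x ≤ 1 / 4) :
    1 - 4 * (q * x) ^ 2 ≤ sineRatio q x := by
  have hq1 : (1 : ℝ) ≤ q := by exact_mod_cast Nat.one_le_iff_ne_zero.2 hq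
  rcases hx.eq_or_lt with rfl | hx
  · simp [sineRatio]
  have hpi := Real.pi_gt_three
  have hpi' := Real.pi_lt_four
  have hz : 0 < q * Real.pi * x := by positivity
  have hz1 : q * Real.pi * x ≤ 1 := by nlinarith [mul_pos (by linarith : (0 : ℝ) < q) hx]
  have hsin := Real.sin_gt_sub_cube hz
  have hx1 : x ≤ 1 / 4 := by nlinarith
  have hs : 0 < Real.sin (Real.pi * x) :=
    Real.sin_pos_of_pos_of_lt_pi (by positivity) (by nlinarith)
  have hs' : Real.sin (Real.pi * x) < Real.pi * x := Real.sin_lt (by positivity)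
  have h := sineRatio_mul q hq x
  rw [abs_of_pos hs] at h
  have h1 := le_abs_self (Real.sin (q * Real.pi * x))
  have h0 := sineRatio_nonneg q x
  have h2 : sineRatio q x * (q * Real.sin (Real.pi * x)) ≤ sineRatio q x * (q * Real.pi * x) := by
    refine mul_le_mul_of_nonneg_left ?_ h0
    nlinarith
  have h3 : q * Real.pi * x * (1 - (q * Real.pi * x) ^ 2 / 4) ≤
      q * Real.pi * x * sineRatio q x := by nlinarith [pow_pos hz 3]
  have h4 := le_of_mul_le_mul_left h3 hz
  have h5 : Real.pi ^ 2 ≤ 16 := by nlinarith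
  have h6 : (q * Real.pi * x) ^ 2 / 4 ≤ 4 * (q * x) ^ 2 := by
    have : (q * Real.pi * x) ^ 2 = Real.pi ^ 2 * (q * x) ^ 2 := by ring
    nlinarith [sq_nonneg ((q : ℝ) * x)]
  linarith

theorem half_le_prod_sineRatio {q : ℕ} (hq : q ≠ 0) {s y : ℝ} (hs : 2 ≤ s) (hy : 0 ≤ y)
    (hqy : q * y ≤ 1 / 4) (n : ℕ) :
    1 / 2 ≤ ∏ i ∈ Finset.range n, sineRatio q (y / s ^ i) := by
  -- The bound 1/2 alone is not inductive. The surplus `4 ^ (-n) / 3` pays for the next factor,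
  -- which is at least `1 - 4 ^ (-n) / 4`.
  have key : 2 / 3 + 1 / 3 * (1 / 4 : ℝ) ^ n ≤ ∏ i ∈ Finset.range n, sineRatio q (y / s ^ i) := by
    induction n with
    | zero => norm_num
    | succ n ih =>
      rw [Finset.prod_range_succ]
      have hq0 : (0 : ℝ) ≤ q := Nat.cast_nonneg q
      have hsn : (2 : ℝ) ^ n ≤ s ^ n := pow_le_pow_left₀ two_pos.le hs n
      have h2n : (1 : ℝ) ≤ 2 ^ n := one_le_pow₀ one_le_two
      have h1 : q * (y / s ^ n) ≤ 1 / 4 * (1 / 2) ^ n := by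
        rw [← mul_div_assoc, one_div_pow, mul_one_div]
        gcongr
      have h2 : (1 / 2 : ℝ) ^ n ≤ 1 := pow_le_one₀ (by norm_num) (by norm_num)
      have h3 := one_sub_sq_le_sineRatio hq (x := y / s ^ n) (by positivity) (by linarith)
      have h4 : (q * (y / s ^ n)) ^ 2 ≤ (1 / 4 * (1 / 2) ^ n) ^ 2 :=
        pow_le_pow_left₀ (by positivity) h1 2
      have h5 : (1 / 4 * (1 / 2 : ℝ) ^ n) ^ 2 = 1 / 16 * (1 / 4) ^ n := by
        rw [mul_pow, ← pow_mul, mul_comm n 2, pow_mul]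
        norm_num
      have h6 : (1 / 4 : ℝ) ^ n ≤ 1 := pow_le_one₀ (by norm_num) (by norm_num)
      have h7 : (0 : ℝ) < (1 / 4 : ℝ) ^ n := by positivity
      have h8 : 1 - 1 / 4 * (1 / 4 : ℝ) ^ n ≤ sineRatio q (y / s ^ n) := by
        rw [h5] at h4; linarith
      refine le_trans ?_ (mul_le_mul ih h8 (by linarith) (prod_sineRatio_nonneg _ _ _))
      rw [pow_succ]
      nlinarith
  have : (0 : ℝ) < (1 / 4 : ℝ) ^ n := by positivity
  linarith

/-- A finite product of sine ratios is comparable to the infinite one once the remaining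
arguments are small. -/
theorem prod_sineRatio_le_two_mul_tprod {q : ℕ} (hq : q ≠ 0) {s z : ℝ} (hs : 2 ≤ s) (hz : 0 ≤ z)
    (k n : ℕ) (hqz : q * (z / s ^ (k + n)) ≤ 1 / 4) :
    ∏ i ∈ Finset.range n, sineRatio q (z / s ^ (k + i)) ≤
      2 * ∏' i : ℕ, sineRatio q (z / s ^ (k + i)) := by
  have hlim := tendsto_prod_range_tprod (fun i => sineRatio_nonneg q (z / s ^ (k + i)))
    fun i => sineRatio_le_one q (z / s ^ (k + i))
  have h : 1 / 2 * ∏ i ∈ Finset.range n, sineRatio q (z / s ^ (k + i)) ≤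
      ∏' i : ℕ, sineRatio q (z / s ^ (k + i)) := by
    refine ge_of_tendsto hlim ?_
    filter_upwards [Filter.eventually_ge_atTop n] with N hN
    obtain ⟨d, rfl⟩ := Nat.exists_eq_add_of_le hN
    rw [Finset.prod_range_add, mul_comm]
    refine mul_le_mul_of_nonneg_left ?_ (prod_sineRatio_nonneg _ _ _)
    have h1 := half_le_prod_sineRatio hq hs (y := z / s ^ (k + n)) (by positivity) hqz d
    refine h1.trans (le_of_eq (Finset.prod_congr rfl fun i _ => ?_))
    rw [div_div, ← pow_add, add_assoc]
  linarith

/-! ### The sine product bound -/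

theorem sineBound_zero (p : ℕ → ℕ) (r s : ℕ) : SineBound p r s 0 := by
  intro N K l _
  rw [sub_zero, Real.rpow_one]
  refine (Finset.sum_le_card_nsmul _ _ 1 fun n _ => tprod_sineRatio_le_one _ _).trans ?_
  rw [Finset.card_range, nsmul_eq_mul, mul_one]
  have : (0 : ℝ) ≤ N := Nat.cast_nonneg N
  linarith

theorem SineBound.mono {p : ℕ → ℕ} {r s : ℕ} {a b : ℝ} (h : SineBound p r s a) (hba : b ≤ a)
    (ha : a ≤ 1 / 2) : SineBound p r s b := by
  intro N K l hl
  refine (h N K l hl).trans ?_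
  rcases N.eq_zero_or_pos with rfl | hN
  · rw [Nat.cast_zero, Real.zero_rpow (by linarith), Real.zero_rpow (by linarith)]
  · have h1 : (1 : ℝ) ≤ N := by exact_mod_cast hN
    have := Real.rpow_le_rpow_of_exponent_le h1 (by linarith : 1 - a ≤ 1 - b)
    linarith

/-- The right-hand side is continuous in the exponent, so the supremum defining `alpha` is attained.
-/
theorem sineBound_of_forall_lt {p : ℕ → ℕ} {r s : ℕ} {a : ℝ} (ha : a ≤ 1 / 2)
    (h : ∀ b < a, SineBound p r s b) : SineBound p r s a := by
  intro N K l hl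
  rcases N.eq_zero_or_pos with rfl | hN
  · rw [Nat.cast_zero, Real.zero_rpow (by linarith)]
    simp
  · have hN' : (0 : ℝ) < N := by exact_mod_cast hN
    have hc : Continuous fun b : ℝ => 2 * (N : ℝ) ^ (1 - b) :=
      continuous_const.mul (Continuous.rpow continuous_const (by fun_prop) fun _ => Or.inl hN'.ne')
    refine ge_of_tendsto ((hc.tendsto a).mono_left nhdsWithin_le_nhds : Filter.Tendsto _
      (nhdsWithin a (Set.Iio a)) _) ?_
    filter_upwards [self_mem_nhdsWithin] with b hb
    exact h b hb N K l hl

theorem zero_mem_alpha_set (p : ℕ → ℕ) (r s : ℕ) :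
    (0 : ℝ) ∈ {a : ℝ | 0 ≤ a ∧ a ≤ 1 / 2 ∧ SineBound p r s a ∧ SineBound p s r a} :=
  ⟨le_rfl, by norm_num, sineBound_zero p r s, sineBound_zero p s r⟩

theorem alpha_set_bddAbove (p : ℕ → ℕ) (r s : ℕ) :
    BddAbove {a : ℝ | 0 ≤ a ∧ a ≤ 1 / 2 ∧ SineBound p r s a ∧ SineBound p s r a} :=
  ⟨1 / 2, fun _ h => h.2.1⟩

theorem alpha_nonneg (p : ℕ → ℕ) (r s : ℕ) : 0 ≤ alpha p r s :=
  le_csSup (alpha_set_bddAbove p r s) (zero_mem_alpha_set p r s)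

theorem alpha_le_half (p : ℕ → ℕ) (r s : ℕ) : alpha p r s ≤ 1 / 2 :=
  csSup_le ⟨0, zero_mem_alpha_set p r s⟩ fun _ h => h.2.1

theorem sineBound_alpha (p : ℕ → ℕ) (r s : ℕ) : SineBound p r s (alpha p r s) := by
  refine sineBound_of_forall_lt (alpha_le_half p r s) fun b hb => ?_
  obtain ⟨a, ha, hba⟩ := exists_lt_of_lt_csSup ⟨0, zero_mem_alpha_set p r s⟩ hb
  exact ha.2.2.1.mono hba.le ha.2.1

theorem beta_set_bddBelow (p u : ℕ → ℕ) (m : ℕ) :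
    BddBelow ({x : ℝ | ∃ i j : ℕ, 1 ≤ i ∧ i ≤ j ∧ j ≤ m ∧ ¬ BaseEquiv (u i) (u j) ∧
      x = alpha p (u i) (u j)} ∪ {1 / 2}) := by
  refine ⟨0, ?_⟩
  rintro x (⟨i, j, -, -, -, -, rfl⟩ | rfl)
  · exact alpha_nonneg _ _ _
  · norm_num

theorem beta_le_half (p u : ℕ → ℕ) (m : ℕ) : beta p u m ≤ 1 / 2 :=
  csInf_le (beta_set_bddBelow p u m) (Or.inr rfl)

theorem beta_nonneg (p u : ℕ → ℕ) (m : ℕ) : 0 ≤ beta p u m := by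
  refine le_csInf ⟨_, Or.inr rfl⟩ ?_
  rintro x (⟨i, j, -, -, -, -, rfl⟩ | rfl)
  · exact alpha_nonneg _ _ _
  · norm_num

theorem sineBound_beta (p u : ℕ → ℕ) {m h : ℕ} (h1 : 1 ≤ h) (hm : h ≤ m)
    (hne : ¬ BaseEquiv (u h) (u m)) : SineBound p (u h) (u m) (beta p u m) :=
  (sineBound_alpha p (u h) (u m)).mono
    (csInf_le (beta_set_bddBelow p u m) (Or.inl ⟨h, m, h1, hm, le_rfl, hne, rfl⟩))
    (alpha_le_half _ _ _)

/-- Each denominator is `s` times the next numerator. The multiplied form avoids dividing by a sine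
that may vanish. -/
theorem prod_sineRatio_telescope {s : ℕ} (hs : s ≠ 0) (x : ℝ) (n : ℕ) :
    (∏ i ∈ Finset.range n, sineRatio s (x / (s : ℝ) ^ (i + 1))) *
      ((s : ℝ) ^ n * |Real.sin (Real.pi * (x / (s : ℝ) ^ n))|) = |Real.sin (Real.pi * x)| := by
  have hs' : (s : ℝ) ≠ 0 := by exact_mod_cast hs
  induction n with
  | zero => simp
  | succ n ih =>
    have h := sineRatio_mul s hs (x / (s : ℝ) ^ (n + 1))
    rw [show s * Real.pi * (x / (s : ℝ) ^ (n + 1)) = Real.pi * (x / (s : ℝ) ^ n) by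
      field_simp
      ring] at h
    rw [← ih, ← h, Finset.prod_range_succ, pow_succ]
    ring

/-- Stop the telescoped product once `x / s ^ n ≤ 1/2`. There `sin (π y) ≥ 2 y`, so the denominator
is at least `2 x`. -/
theorem tprod_sineRatio_self_le {s : ℕ} (hs : 2 ≤ s) {x : ℝ} (hx : 0 < x) :
    ∏' i : ℕ, sineRatio s (x / (s : ℝ) ^ (i + 1)) ≤ 1 / (2 * x) := by
  have hs' : (1 : ℝ) < s := by exact_mod_cast hs
  obtain ⟨n, hn⟩ := pow_unbounded_of_one_lt (2 * x) hs'
  refine (tprod_sineRatio_le_prod s _ n).trans ?_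
  have hsn : (0 : ℝ) < (s : ℝ) ^ n := by positivity
  have h := prod_sineRatio_telescope (by omega : s ≠ 0) x n
  have hpi := Real.pi_pos
  have hy : x / (s : ℝ) ^ n ≤ 1 / 2 := by
    rw [div_le_iff₀ hsn]; linarith
  have h1 := Real.mul_le_sin (x := Real.pi * (x / (s : ℝ) ^ n)) (by positivity) (by nlinarith)
  have h2 : 2 * (x / (s : ℝ) ^ n) ≤ |Real.sin (Real.pi * (x / (s : ℝ) ^ n))| := by
    refine le_trans (le_of_eq ?_) (h1.trans (le_abs_self _))
    field_simp
  have h3 : 2 * x ≤ (s : ℝ) ^ n * |Real.sin (Real.pi * (x / (s : ℝ) ^ n))| := by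
    calc 2 * x = (s : ℝ) ^ n * (2 * (x / (s : ℝ) ^ n)) := by field_simp
      _ ≤ _ := mul_le_mul_of_nonneg_left h2 hsn.le
  rw [le_div_iff₀ (by positivity)]
  calc _ ≤ _ := mul_le_mul_of_nonneg_left h3 (prod_sineRatio_nonneg _ _ _)
    _ ≤ 1 := by rw [h]; exact Real.abs_sin_le_one _

/-- With all digits allowed the products telescope, and the bound holds with every exponent. -/
theorem sineBound_full {r s : ℕ} (hr : 2 ≤ r) (hs : 2 ≤ s) {a : ℝ} (ha : a ≤ 1 / 2) :
    SineBound (fun _ => s) r s a := by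
  intro N K l hl
  have hr' : (2 : ℝ) ≤ r := by exact_mod_cast hr
  rcases N.eq_zero_or_pos with rfl | hN
  · rw [Nat.cast_zero, Real.zero_rpow (by linarith)]
    simp
  have h1 : ∀ n ∈ Finset.range N,
      ∏' i : ℕ, sineRatio s ((r : ℝ) ^ n * l / (s : ℝ) ^ (K + 1 + i)) ≤ (1 / 2 : ℝ) ^ n := by
    intro n _
    have hsK : (0 : ℝ) < (s : ℝ) ^ K := by positivity
    have hl' : (s : ℝ) ^ K ≤ l := by exact_mod_cast hl
    have hl0 : (0 : ℝ) < l := hsK.trans_le hl'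
    have hrn : (2 : ℝ) ^ n ≤ (r : ℝ) ^ n := pow_le_pow_left₀ two_pos.le hr' n
    have h2 := tprod_sineRatio_self_le hs (x := (r : ℝ) ^ n * l / (s : ℝ) ^ K) (by positivity)
    -- The condition `l ≥ s ^ K` makes the argument grow at least like `2 ^ n`, so the sum over `n`
    -- is dominated by a geometric series.
    have h3 : (2 : ℝ) ^ n ≤ (r : ℝ) ^ n * l / (s : ℝ) ^ K := by
      rw [le_div_iff₀ hsK]
      exact mul_le_mul hrn hl' hsK.le (by positivity)
    have h4 : ∀ i : ℕ, (r : ℝ) ^ n * l / (s : ℝ) ^ K / (s : ℝ) ^ (i + 1) =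
        (r : ℝ) ^ n * l / (s : ℝ) ^ (K + 1 + i) := fun i => by
      rw [div_div, ← pow_add, add_assoc K 1 i, add_comm 1 i]
    simp only [h4] at h2
    refine h2.trans ?_
    have h2n : (0 : ℝ) < 2 ^ n := by positivity
    rw [one_div_pow]
    refine one_div_le_one_div_of_le h2n ?_
    linarith
  refine (Finset.sum_le_sum h1).trans ?_
  have hN' : (1 : ℝ) ≤ N := by exact_mod_cast hN
  have h5 : (1 : ℝ) ≤ (N : ℝ) ^ (1 - a) := Real.one_le_rpow hN' (by linarith)
  have h6 : ∑ n ∈ Finset.range N, (1 / 2 : ℝ) ^ n ≤ 2 := by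
    simpa using sum_geometric_two_le N
  linarith

/-! ### Sums over pairs -/

theorem sum_sum_le_two_mul_diagonals {g : ℕ → ℕ → ℝ} (h0 : ∀ x y, 0 ≤ g x y)
    (hsymm : ∀ x y, g x y = g y x) (R : ℕ) :
    ∑ x ∈ Finset.range R, ∑ y ∈ Finset.range R, g x y ≤
      2 * ∑ d ∈ Finset.range R, ∑ x ∈ Finset.range (R - d), g x (x + d) := by
  have h1 := Finset.sum_range_diag_flip R (fun d x => g x (x + d))
  rw [← h1]
  clear h1
  induction R with
  | zero => simp
  | succ R ih =>
    rw [Finset.sum_range_succ, Finset.sum_range_succ (fun m => ∑ k ∈ Finset.range (m + 1), _)]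
    simp only [Finset.sum_range_succ (fun y => g _ y) R, Finset.sum_add_distrib]
    have h2 : ∑ k ∈ Finset.range (R + 1), g (R - k) (R - k + k) =
        ∑ x ∈ Finset.range R, g x R + g R R := by
      rw [← Finset.sum_range_succ (fun x => g x R), ← Finset.sum_range_reflect]
      refine Finset.sum_congr rfl fun k hk => ?_
      rw [Finset.mem_range] at hk
      congr 1 <;> omega
    have h3 : ∑ y ∈ Finset.range R, g R y = ∑ x ∈ Finset.range R, g x R :=
      Finset.sum_congr rfl fun y _ => hsymm _ _
    rw [h2, h3]
    have := h0 R R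
    linarith

/-- Diagonals with `d < k` contribute at most `k R`, the last `k` entries of the others again at
most `k R`, and the rest at most `R B`. Symmetry doubles all three. -/
theorem sum_sum_le_of_diagonals {g : ℕ → ℕ → ℝ} (h0 : ∀ x y, 0 ≤ g x y) (h1 : ∀ x y, g x y ≤ 1)
    (hsymm : ∀ x y, g x y = g y x) {R k : ℕ} {B : ℝ} (hB : 0 ≤ B)
    (h : ∀ d, k ≤ d → ∑ x ∈ Finset.range (R - d - k), g x (x + d) ≤ B) :
    ∑ x ∈ Finset.range R, ∑ y ∈ Finset.range R, g x y ≤ 4 * k * R + 2 * R * B := by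
  refine (sum_sum_le_two_mul_diagonals h0 hsymm R).trans ?_
  have hd : ∀ d ∈ Finset.range R, ∑ x ∈ Finset.range (R - d), g x (x + d) ≤
      (if d < k then (R : ℝ) else 0) + (k + B) := by
    intro d _
    have hle : ∀ n c : ℕ, ∑ x ∈ Finset.range n, g (c + x) (c + x + d) ≤ n := fun n c => by
      simpa using Finset.sum_le_card_nsmul (Finset.range n) _ 1 fun x _ => h1 (c + x) (c + x + d)
    have hk : (0 : ℝ) ≤ k := Nat.cast_nonneg k
    split_ifs with hdk
    · have h2 := hle (R - d) 0
      simp only [zero_add] at h2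
      have h3 : ((R - d : ℕ) : ℝ) ≤ R := by exact_mod_cast Nat.sub_le R d
      linarith
    · rw [show R - d = (R - d - k) + ((R - d) - (R - d - k)) by omega, Finset.sum_range_add]
      have h2 := hle ((R - d) - (R - d - k)) (R - d - k)
      have h3 : (((R - d) - (R - d - k) : ℕ) : ℝ) ≤ k := by exact_mod_cast (by omega)
      have h4 := h d (not_lt.1 hdk)
      linarith
  have hcard : ∑ d ∈ Finset.range R, (if d < k then (R : ℝ) else 0) ≤ k * R := by
    rw [← Finset.sum_filter, Finset.sum_const, nsmul_eq_mul]
    refine mul_le_mul_of_nonneg_right ?_ (Nat.cast_nonneg R)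
    have : ((Finset.range R).filter fun d => d < k) ⊆ Finset.range k := fun d hd => by
      simpa using (Finset.mem_filter.1 hd).2
    exact_mod_cast (Finset.card_le_card this).trans (by simp)
  have h2 := Finset.sum_le_sum hd
  rw [Finset.sum_add_distrib, Finset.sum_const, Finset.card_range, nsmul_eq_mul] at h2
  nlinarith

/-! ### Mean squares over digit strings -/

theorem sum_norm_sq_le {ι κ : Type*} [Fintype κ] (J : Finset ι) (ω : ι → ℝ) (x : κ → ℝ) :
    ∑ c, ‖∑ j ∈ J, e (ω j * x c)‖ ^ 2 ≤
      ∑ j ∈ J, ∑ k ∈ J, ‖∑ c, e ((ω j - ω k) * x c)‖ := by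
  have h : ((∑ c, ‖∑ j ∈ J, e (ω j * x c)‖ ^ 2 : ℝ) : ℂ) =
      ∑ j ∈ J, ∑ k ∈ J, ∑ c, e ((ω j - ω k) * x c) := by
    push_cast
    have h1 : ∀ c, ((‖∑ j ∈ J, e (ω j * x c)‖ : ℝ) : ℂ) ^ 2 =
        ∑ j ∈ J, ∑ k ∈ J, e ((ω j - ω k) * x c) := by
      intro c
      rw [← Complex.mul_conj', map_sum, Finset.sum_mul_sum]
      refine Finset.sum_congr rfl fun j _ => Finset.sum_congr rfl fun k _ => ?_
      rw [conj_e, ← e_add]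
      congr 1
      ring
    simp only [h1]
    rw [Finset.sum_comm]
    refine Finset.sum_congr rfl fun j _ => ?_
    rw [Finset.sum_comm]
  have h0 : 0 ≤ ∑ c, ‖∑ j ∈ J, e (ω j * x c)‖ ^ 2 := Finset.sum_nonneg fun _ _ => by positivity
  calc _ = ‖((∑ c, ‖∑ j ∈ J, e (ω j * x c)‖ ^ 2 : ℝ) : ℂ)‖ := by
        rw [Complex.norm_real, Real.norm_of_nonneg h0]
    _ ≤ _ := by
        rw [h]
        exact (norm_sum_le _ _).trans (Finset.sum_le_sum fun j _ => norm_sum_le _ _)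

/-- The exponential of a digit sum factors over the positions, and each factor summed over its digit
is a geometric sum. The starting point `η` enters only through a factor of modulus 1. -/
theorem norm_sum_e_digits {q : ℕ} (hq : q ≠ 0) (s η L : ℝ) (a n : ℕ) :
    ‖∑ c : Fin n → Fin q, e (L * (η + ∑ k, ((c k : ℕ) : ℝ) / s ^ (a + 1 + (k : ℕ))))‖ =
      (q : ℝ) ^ n * ∏ i ∈ Finset.range n, sineRatio q (L / s ^ (a + 1 + i)) := by
  have h1 : ∀ c : Fin n → Fin q, e (L * (η + ∑ k, ((c k : ℕ) : ℝ) / s ^ (a + 1 + (k : ℕ)))) =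
      e (L * η) * ∏ k : Fin n, e (((c k : ℕ) : ℝ) * (L / s ^ (a + 1 + (k : ℕ)))) := by
    intro c
    rw [← e_finset_sum, ← e_add, mul_add, Finset.mul_sum]
    congr 2
    refine Finset.sum_congr rfl fun k _ => ?_
    ring
  simp only [h1]
  rw [← Finset.mul_sum, norm_mul, norm_e, one_mul]
  have h2 := Finset.prod_univ_sum (fun _ : Fin n => (Finset.univ : Finset (Fin q)))
    (fun k v => e (((v : ℕ) : ℝ) * (L / s ^ (a + 1 + (k : ℕ)))))
  rw [Fintype.piFinset_univ] at h2
  rw [← h2, norm_prod, ← Fin.prod_univ_eq_prod_range (fun i => sineRatio q (L / s ^ (a + 1 + i)))]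
  have h3 : (q : ℝ) ^ n = ∏ _k : Fin n, (q : ℝ) := by simp
  rw [h3, ← Finset.prod_mul_distrib]
  refine Finset.prod_congr rfl fun k _ => ?_
  rw [Fin.sum_univ_eq_sum_range (fun v => e ((v : ℝ) * (L / s ^ (a + 1 + (k : ℕ))))),
    norm_sum_e_eq q hq]

theorem sum_Icc_succ_eq_sum_range {M : Type*} [AddCommMonoid M] (f : ℕ → M) (A B : ℕ) :
    ∑ j ∈ Finset.Icc (A + 1) B, f (j - 1) = ∑ x ∈ Finset.range (B - A), f (A + x) := by
  rw [← Finset.Ico_add_one_right_eq_Icc, Finset.sum_Ico_eq_sum_range]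
  rw [show B + 1 - (A + 1) = B - A by omega]
  refine Finset.sum_congr rfl fun x _ => ?_
  congr 1
  omega

/-- The finite sine products along a fixed difference `d` of exponents: the arguments exceed
`s ^ a` from the beginning and are small compared to `s ^ (a + 1 + n)`. -/
theorem sum_diagonal_le {q r s a A B n k d t : ℕ} {β : ℝ} (hq : q ≠ 0) (hqs : q ≤ s) (hs : 2 ≤ s)
    (hr : 2 ≤ r) (hβ : β ≤ 1 / 2) (hsine : SineBound (fun _ => q) r s β) (ht : t ≠ 0)
    (hA : s ^ a ≤ s * r ^ A) (hB : r ^ B ≤ r * s ^ (a + 2 + n)) (hk : 4 * t * s ^ 2 ≤ 2 ^ k)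
    (hkd : k ≤ d) :
    ∑ x ∈ Finset.range (B - A - d - k),
      ∏ i ∈ Finset.range n, sineRatio q
        (((r : ℝ) ^ (A + x) * t - (r : ℝ) ^ (A + (x + d)) * t) / (s : ℝ) ^ (a + 1 + i)) ≤
      4 * ((B - A : ℕ) : ℝ) ^ (1 - β) := by
  have ht1 : 1 ≤ t := Nat.one_le_iff_ne_zero.2 ht
  -- Up to sign, the difference of the frequencies at `A + x` and `A + (x + d)` is `r ^ x * l`; the
  -- sign is harmless because `sineRatio` is even.
  set l : ℕ := r ^ A * t * (r ^ d - 1) with hl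
  have hd1 : 1 ≤ r ^ d := Nat.one_le_pow _ _ (by omega)
  have hlR : (l : ℝ) = (r : ℝ) ^ A * t * ((r : ℝ) ^ d - 1) := by
    rw [hl]
    push_cast [Nat.cast_sub hd1]
    ring
  have hrd : 2 ^ k ≤ r ^ d :=
    (Nat.pow_le_pow_right two_pos hkd).trans (Nat.pow_le_pow_left hr d)
  have hsl : s ^ a ≤ l := by
    have h1 : s ≤ r ^ d - 1 := by
      have : s + 1 ≤ 4 * t * s ^ 2 := by nlinarith
      omega
    calc s ^ a ≤ s * r ^ A := hA
      _ = r ^ A * 1 * s := by ring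
      _ ≤ r ^ A * t * (r ^ d - 1) := by gcongr
  have hterm : ∀ x i : ℕ, sineRatio q
      (((r : ℝ) ^ (A + x) * t - (r : ℝ) ^ (A + (x + d)) * t) / (s : ℝ) ^ (a + 1 + i)) =
      sineRatio q ((r : ℝ) ^ x * l / (s : ℝ) ^ (a + 1 + i)) := by
    intro x i
    rw [← sineRatio_neg, hlR]
    congr 1
    rw [pow_add, pow_add, pow_add]
    ring
  simp only [hterm]
  have hsR : (2 : ℝ) ≤ s := by exact_mod_cast hs
  have hle : ∀ x ∈ Finset.range (B - A - d - k),
      ∏ i ∈ Finset.range n, sineRatio q ((r : ℝ) ^ x * l / (s : ℝ) ^ (a + 1 + i)) ≤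
        2 * ∏' i : ℕ, sineRatio q ((r : ℝ) ^ x * l / (s : ℝ) ^ (a + 1 + i)) := by
    intro x hx
    rw [Finset.mem_range] at hx
    refine prod_sineRatio_le_two_mul_tprod hq hsR (by positivity) _ _ ?_
    -- Stopping `k` terms early leaves a spare factor `r ^ k ≥ 2 ^ k`. It absorbs the `4 t s ^ 2`
    -- needed to bring the argument of the first omitted sine ratio, multiplied by `q`, below 1/4.
    have h1 : r ^ x * l * 2 ^ k * r ≤ t * s ^ (a + 2 + n) * r := by
      calc r ^ x * l * 2 ^ k * r ≤ r ^ x * (r ^ A * t * r ^ d) * r ^ k * r := by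
            gcongr
            exact Nat.mul_le_mul_left _ (Nat.sub_le _ _)
        _ = t * r ^ (x + A + d + k + 1) := by ring
        _ ≤ t * r ^ B := by
            gcongr
            · omega
            · omega
        _ ≤ t * (r * s ^ (a + 2 + n)) := by gcongr
        _ = _ := by ring
    have h2 : r ^ x * l * 2 ^ k ≤ t * s ^ (a + 2 + n) := Nat.le_of_mul_le_mul_right h1 (by omega)
    have h3 : 4 * (s * (r ^ x * l)) * 2 ^ k ≤ s ^ (a + 1 + n) * 2 ^ k := by
      calc 4 * (s * (r ^ x * l)) * 2 ^ k = 4 * s * (r ^ x * l * 2 ^ k) := by ring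
        _ ≤ 4 * s * (t * s ^ (a + 2 + n)) := by gcongr
        _ = s ^ (a + 1 + n) * (4 * t * s ^ 2) := by ring
        _ ≤ _ := by gcongr
    have h4 : 4 * (q * (r ^ x * l)) ≤ s ^ (a + 1 + n) :=
      le_trans (by gcongr) (Nat.le_of_mul_le_mul_right h3 (by positivity))
    have h5 : (4 : ℝ) * (q * ((r : ℝ) ^ x * l)) ≤ (s : ℝ) ^ (a + 1 + n) := by exact_mod_cast h4
    rw [← mul_div_assoc, div_le_iff₀ (by positivity)]
    linarith
  refine (Finset.sum_le_sum hle).trans ?_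
  rw [← Finset.mul_sum]
  have h1 := hsine (B - A - d - k) a l hsl
  have h2 : ((B - A - d - k : ℕ) : ℝ) ^ (1 - β) ≤ ((B - A : ℕ) : ℝ) ^ (1 - β) := by
    refine Real.rpow_le_rpow (Nat.cast_nonneg _) ?_ (by linarith)
    exact_mod_cast (by omega)
  linarith

theorem mean_square_le_of_pos {q r s a A B n k t : ℕ} {β : ℝ} (η : ℝ) (hq : q ≠ 0) (hqs : q ≤ s)
    (hs : 2 ≤ s) (hr : 2 ≤ r) (hβ : β ≤ 1 / 2) (hsine : SineBound (fun _ => q) r s β) (ht : t ≠ 0)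
    (hA : s ^ a ≤ s * r ^ A) (hB : r ^ B ≤ r * s ^ (a + 2 + n)) (hk : 4 * t * s ^ 2 ≤ 2 ^ k) :
    ∑ c : Fin n → Fin q, ‖∑ j ∈ Finset.Icc (A + 1) B, e ((r : ℝ) ^ (j - 1) * t *
        (η + ∑ i, ((c i : ℕ) : ℝ) / (s : ℝ) ^ (a + 1 + (i : ℕ))))‖ ^ 2 ≤
      (q : ℝ) ^ n * (4 * k * ((B - A : ℕ) : ℝ) +
        8 * ((B - A : ℕ) : ℝ) * ((B - A : ℕ) : ℝ) ^ (1 - β)) := by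
  have hreidx : ∀ y : ℝ, ∑ j ∈ Finset.Icc (A + 1) B, e ((r : ℝ) ^ (j - 1) * t * y) =
      ∑ x ∈ Finset.range (B - A), e ((r : ℝ) ^ (A + x) * t * y) := fun y =>
    sum_Icc_succ_eq_sum_range (fun j => e ((r : ℝ) ^ j * t * y)) A B
  simp only [hreidx]
  refine (sum_norm_sq_le (Finset.range (B - A)) (fun x => (r : ℝ) ^ (A + x) * t) _).trans ?_
  simp only [norm_sum_e_digits hq, ← Finset.mul_sum]
  refine mul_le_mul_of_nonneg_left ?_ (by positivity)
  have h := sum_sum_le_of_diagonals (R := B - A) (k := k) (B := 4 * ((B - A : ℕ) : ℝ) ^ (1 - β))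
    (g := fun x y => ∏ i ∈ Finset.range n, sineRatio q
        (((r : ℝ) ^ (A + x) * t - (r : ℝ) ^ (A + y) * t) / (s : ℝ) ^ (a + 1 + i)))
    (fun x y => prod_sineRatio_nonneg _ _ _) (fun x y => prod_sineRatio_le_one _ _ _)
    (fun x y => Finset.prod_congr rfl fun i _ => by
      rw [← sineRatio_neg]
      congr 1
      ring)
    (by positivity)
    (fun d hd => sum_diagonal_le hq hqs hs hr hβ hsine ht hA hB hk hd)
  refine h.trans (le_of_eq ?_)
  ring

theorem norm_sum_e_neg {ι : Type*} (J : Finset ι) (f : ι → ℝ) :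
    ‖∑ j ∈ J, e (-f j)‖ = ‖∑ j ∈ J, e (f j)‖ := by
  simp only [← conj_e, ← map_sum, RCLike.norm_conj]

/-- Negative `t` reduces to positive `t` by complex conjugation. -/
theorem mean_square_le {q r s a A B n k : ℕ} {t : ℤ} {β : ℝ} (η : ℝ) (hq : q ≠ 0) (hqs : q ≤ s)
    (hs : 2 ≤ s) (hr : 2 ≤ r) (hβ : β ≤ 1 / 2) (hsine : SineBound (fun _ => q) r s β) (ht : t ≠ 0)
    (hA : s ^ a ≤ s * r ^ A) (hB : r ^ B ≤ r * s ^ (a + 2 + n))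
    (hk : 4 * t.natAbs * s ^ 2 ≤ 2 ^ k) :
    ∑ c : Fin n → Fin q, ‖∑ j ∈ Finset.Icc (A + 1) B, e ((r : ℝ) ^ (j - 1) * t *
        (η + ∑ i, ((c i : ℕ) : ℝ) / (s : ℝ) ^ (a + 1 + (i : ℕ))))‖ ^ 2 ≤
      (q : ℝ) ^ n * (4 * k * ((B - A : ℕ) : ℝ) +
        8 * ((B - A : ℕ) : ℝ) * ((B - A : ℕ) : ℝ) ^ (1 - β)) := by
  obtain ⟨t, rfl | rfl⟩ := Int.eq_nat_or_neg t
  · have h := mean_square_le_of_pos (t := t) η hq hqs hs hr hβ hsine (by simpa using ht) hA hB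
      (by simpa using hk)
    simpa only [Int.cast_natCast] using h
  · have h := mean_square_le_of_pos (t := t) η hq hqs hs hr hβ hsine (by simpa using ht) hA hB
      (by simpa using hk)
    simpa only [Int.cast_neg, Int.cast_natCast, mul_neg, neg_mul, norm_sum_e_neg] using h

/-! ### Low discrepancy strings make up at least half of all strings -/

theorem IsLowDiscrepancy.mono {b : ℕ} {C : ℝ} {N N' : ℕ∞} {w : List (Fin b)} (hN : N ≤ N')
    (h : IsLowDiscrepancy C N w) : IsLowDiscrepancy C N' w := fun z n h1 h2 h3 =>
  h z n (le_trans (by gcongr) h1) (hN.trans h2) h3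

/-- An infimum of natural numbers that is finite in `ℕ∞` is attained. -/
theorem exists_isThreshold {b N : ℕ} {C ε : ℝ} (h : leastThreshold b C ε ≤ N) :
    ∃ N₀ ≤ N, IsThreshold b C ε N₀ := by
  by_contra! hc
  have h1 : ((N + 1 : ℕ) : ℕ∞) ≤ leastThreshold b C ε := by
    refine le_iInf₂ fun N₀ hN₀ => ?_
    by_contra! hlt
    have : N₀ < N + 1 := by exact_mod_cast hlt
    exact hc N₀ (by omega) hN₀
  have h2 : N + 1 ≤ N := by exact_mod_cast h1.trans h
  omega

/-- If the length is at most `N`, the only possible test is `z = []` with the whole string, whose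
outcome depends on the length alone. Low discrepancy is then all or nothing. -/
theorem isLowDiscrepancy_of_length_le {b : ℕ} {C : ℝ} {N : ℕ∞} {w w' : List (Fin b)}
    (hlen : w.length = w'.length) (hN : (w.length : ℕ∞) ≤ N) (h : IsLowDiscrepancy C N w) :
    IsLowDiscrepancy C N w' := by
  intro z n h1 h2 h3
  rw [← hlen] at h1 h3
  have h4 : w.length ≤ n := by exact_mod_cast hN.trans h2
  have hz : z = [] := List.length_eq_zero_iff.1 (by omega)
  subst hz
  have := h [] n h1 h2 h3
  rw [List.take_of_length_le h4] at this
  rw [List.take_of_length_le (by omega)]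
  simpa [occurrenceCount, hlen] using this

theorem card_isLowDiscrepancy_ge {q n : ℕ} {C : ℝ} {N : ℕ∞} (hN : leastThreshold q C (1 / 2) ≤ N)
    (hex : ∃ c : Fin n → Fin q, IsLowDiscrepancy C N (List.ofFn c))
    (G : Finset (Fin n → Fin q)) (hG : ∀ c, c ∈ G ↔ IsLowDiscrepancy C N (List.ofFn c)) :
    (q : ℝ) ^ n ≤ 2 * (G.card : ℝ) := by
  classical
  obtain ⟨c₀, hc₀⟩ := hex
  -- For strings too short for the threshold property, the existence of one low discrepancy string
  -- makes all of them such.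
  by_cases hn : (n : ℕ∞) ≤ N
  · have hall : G = Finset.univ := by
      refine Finset.eq_univ_iff_forall.2 fun c => (hG c).2 ?_
      exact isLowDiscrepancy_of_length_le (by simp) (by simpa using hn) hc₀
    rw [hall]
    have : (0 : ℝ) ≤ (q : ℝ) ^ n := by positivity
    simp
    linarith
  · rw [not_le] at hn
    obtain ⟨N', rfl⟩ := ENat.ne_top_iff_exists.1 hn.ne_top
    have hn' : N' < n := by exact_mod_cast hn
    obtain ⟨N₀, hN₀, hthr⟩ := exists_isThreshold hN
    have h1 := hthr n (by omega)
    have h2 : (Gᶜ : Finset _).card ≤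
        {w : Fin n → Fin q | ¬ IsLowDiscrepancy C N₀ (List.ofFn w)}.ncard := by
      rw [← Set.ncard_coe_finset]
      refine Set.ncard_le_ncard ?_ (Set.toFinite _)
      intro c hc hlow
      rw [Finset.mem_coe, Finset.mem_compl, hG] at hc
      exact hc (hlow.mono (by exact_mod_cast hN₀))
    have h3 : (G.card : ℝ) + (Gᶜ : Finset _).card = (q : ℝ) ^ n := by
      have := Finset.card_add_card_compl G
      simp only [Fintype.card_fun, Fintype.card_fin] at this
      exact_mod_cast this
    have h4 : ((Gᶜ : Finset _).card : ℝ) ≤ 1 / 2 * (q : ℝ) ^ n :=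
      le_trans (by exact_mod_cast h2) h1
    linarith

theorem IsMinimalChoice.A_mul_le {u : ℕ → ℕ} {C : ℕ → ℝ} {N : ℕ → ℕ∞} {m q : ℕ} {y x : ℝ}
    (h : IsMinimalChoice u C N m y q x) (hN : leastThreshold q (C q) (1 / 2) ≤ N q) :
    (q : ℝ) ^ (bIdx u m - aIdx u m - 2) * A u m x ≤ 2 * ∑ c, A u m (sigmaPoint u m y q c) := by
  classical
  obtain ⟨c₀, hc₀, hx, hmin⟩ := h
  have hA0 : ∀ z, 0 ≤ A u m z := fun z =>
    Finset.sum_nonneg fun _ _ => Finset.sum_nonneg fun _ _ => by positivity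
  set G : Finset (Fin (bIdx u m - aIdx u m - 2) → Fin q) :=
    Finset.univ.filter fun c => IsLowDiscrepancy (C q) (N q) (List.ofFn c) with hG
  have hcard := card_isLowDiscrepancy_ge hN ⟨c₀, hc₀⟩ G (by simp [hG])
  have h1 : (G.card : ℝ) * A u m x ≤ ∑ c ∈ G, A u m (sigmaPoint u m y q c) := by
    rw [← nsmul_eq_mul]
    refine Finset.card_nsmul_le_sum _ _ _ fun c hc => ?_
    exact hmin c (by simpa [hG] using hc)
  have h2 : ∑ c ∈ G, A u m (sigmaPoint u m y q c) ≤ ∑ c, A u m (sigmaPoint u m y q c) :=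
    Finset.sum_le_sum_of_subset_of_nonneg (Finset.subset_univ _) fun c _ _ => hA0 _
  nlinarith [hA0 x]

/-! ### Growth of the step lengths -/

/-- The cubic term grows by `2 u(1) (3 m ^ 2 + 3 m + 1)`, which also covers the loss from rounding
up. -/
theorem angle_add_sq_le {u : ℕ → ℕ} (hu : 1 ≤ u 1) {m : ℕ} (hm : 1 ≤ m) :
    (angle u m : ℝ) + (m : ℝ) ^ 2 ≤ angle u (m + 1) := by
  have hm' : (1 : ℝ) ≤ m := by exact_mod_cast hm
  have hu' : (1 : ℝ) ≤ u 1 := by exact_mod_cast hu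
  rw [angle, angle, if_neg (by omega), if_neg (by omega)]
  have h1 := Nat.ceil_lt_add_one (a := Real.exp (Real.sqrt m) + 2 * (u 1 : ℝ) * (m : ℝ) ^ 3)
    (by positivity)
  have h2 := Nat.le_ceil (Real.exp (Real.sqrt ((m + 1 : ℕ) : ℝ)) +
    2 * (u 1 : ℝ) * ((m + 1 : ℕ) : ℝ) ^ 3)
  have h3 : Real.exp (Real.sqrt m) ≤ Real.exp (Real.sqrt ((m + 1 : ℕ) : ℝ)) := by
    gcongr
    simp
  refine le_trans ?_ h2
  push_cast at h3 ⊢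
  nlinarith [mul_le_mul_of_nonneg_left hu' (by positivity : (0 : ℝ) ≤ 3 * (m : ℝ) ^ 2 + 3 * m + 1)]

/-- Together with `pow_angleBase_le`, this puts the powers `r ^ ⟨m; r⟩` of all bases on the common
scale `e ^ ⟨m⟩`, up to a factor `r`. -/
theorem exp_angle_le_pow (u : ℕ → ℕ) (m : ℕ) {r : ℕ} (hr : 2 ≤ r) :
    Real.exp (angle u m) ≤ (r : ℝ) ^ angleBase u m r := by
  have hr' : (1 : ℝ) < r := by exact_mod_cast hr
  have hlog := Real.log_pos hr'
  rw [← Real.rpow_natCast, Real.rpow_def_of_pos (by linarith), Real.exp_le_exp]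
  have := Nat.le_ceil ((angle u m : ℝ) / Real.log r)
  rw [div_le_iff₀ hlog] at this
  rw [angleBase]
  linarith

theorem pow_angleBase_le (u : ℕ → ℕ) (m : ℕ) {r : ℕ} (hr : 2 ≤ r) :
    (r : ℝ) ^ angleBase u m r ≤ r * Real.exp (angle u m) := by
  have hr' : (1 : ℝ) < r := by exact_mod_cast hr
  have hlog := Real.log_pos hr'
  have h := Nat.ceil_lt_add_one (a := (angle u m : ℝ) / Real.log r) (by positivity)
  have h1 : (angleBase u m r : ℝ) * Real.log r ≤ angle u m + Real.log r := by
    calc (angleBase u m r : ℝ) * Real.log r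
        ≤ ((angle u m : ℝ) / Real.log r + 1) * Real.log r :=
          mul_le_mul_of_nonneg_right h.le hlog.le
      _ = _ := by field_simp
  rw [← Real.rpow_natCast, Real.rpow_def_of_pos (by linarith)]
  calc Real.exp (Real.log r * (angleBase u m r : ℝ))
      ≤ Real.exp (angle u m + Real.log r) := by
        rw [Real.exp_le_exp]
        linarith
    _ = _ := by rw [Real.exp_add, Real.exp_log (by linarith), mul_comm]

theorem angleBase_sub_le {u : ℕ → ℕ} (hu : 1 ≤ u 1) {m r : ℕ} (hm : 1 ≤ m) (hr : 2 ≤ r) :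
    ((angleBase u (m + 1) r - angleBase u m r : ℕ) : ℝ) ≤
      3 * ((angle u (m + 1) : ℝ) - angle u m) := by
  have hm' : (1 : ℝ) ≤ m := by exact_mod_cast hm
  have hD := angle_add_sq_le hu hm
  have hD1 : 1 ≤ (angle u (m + 1) : ℝ) - angle u m := by nlinarith
  have hr' : (2 : ℝ) ≤ r := by exact_mod_cast hr
  have hlog : 1 / 2 ≤ Real.log r := by
    have := Real.log_le_log two_pos hr'
    have := Real.log_two_gt_d9
    linarith
  rcases le_total (angleBase u (m + 1) r) (angleBase u m r) with h | h
  · rw [Nat.sub_eq_zero_of_le h, Nat.cast_zero]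
    linarith
  · rw [Nat.cast_sub h]
    have h1 := Nat.ceil_lt_add_one (a := (angle u (m + 1) : ℝ) / Real.log r) (by positivity)
    have h2 := Nat.le_ceil ((angle u m : ℝ) / Real.log r)
    have h3 : ((angle u (m + 1) : ℝ) - angle u m) / Real.log r ≤
        2 * ((angle u (m + 1) : ℝ) - angle u m) := by
      rw [div_le_iff₀ (by linarith)]
      nlinarith
    rw [sub_div] at h3
    rw [angleBase, angleBase]
    linarith

/-! ### Convergence -/

theorem digit_sum_le {s q : ℕ} (hs : 1 ≤ s) (hqs : q ≤ s) (a n : ℕ) (c : Fin n → Fin q) :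
    ∑ k, ((c k : ℕ) : ℝ) / (s : ℝ) ^ (a + 1 + (k : ℕ)) ≤ 1 / (s : ℝ) ^ a := by
  have hs' : (1 : ℝ) ≤ s := by exact_mod_cast hs
  have h1 : ∀ k : Fin n, ((c k : ℕ) : ℝ) / (s : ℝ) ^ (a + 1 + (k : ℕ)) ≤
      ((s : ℝ) - 1) / (s : ℝ) ^ (a + 1 + (k : ℕ)) := fun k => by
    have h2 : ((c k : ℕ) : ℝ) + 1 ≤ s := by
      exact_mod_cast (Nat.succ_le_of_lt (c k).2).trans hqs
    gcongr
    linarith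
  refine (Finset.sum_le_sum fun k _ => h1 k).trans ?_
  rw [Fin.sum_univ_eq_sum_range (fun k => ((s : ℝ) - 1) / (s : ℝ) ^ (a + 1 + k))]
  have h3 : ∑ k ∈ Finset.range n, ((s : ℝ) - 1) / (s : ℝ) ^ (a + 1 + k) =
      1 / (s : ℝ) ^ a - 1 / (s : ℝ) ^ (a + n) := by
    induction n with
    | zero => simp
    | succ n ih =>
      rw [Finset.sum_range_succ, ih (fun k => c k.castSucc) (fun k => h1 k.castSucc)]
      have : (s : ℝ) ≠ 0 := by linarith
      field_simp
      ring
  rw [h3]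
  have : 0 ≤ 1 / (s : ℝ) ^ (a + n) := by positivity
  linarith

/-- Rounding up to the grid costs at most `u(m) ^ (-a_m)`, the digits at most as much again, and
`u(m) ^ (-a_m) ≤ e ^ (-⟨m⟩)`. -/
theorem IsMinimalChoice.mem_Icc {u : ℕ → ℕ} {C : ℕ → ℝ} {N : ℕ → ℕ∞} {m q : ℕ} {y x : ℝ}
    (h : IsMinimalChoice u C N m y q x) (hu : 2 ≤ u m) (hq : q ≤ u m) (hy : 0 ≤ y) :
    y ≤ x ∧ x ≤ y + 2 * Real.exp (-angle u m) := by
  obtain ⟨c, -, rfl, -⟩ := h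
  have hs : (0 : ℝ) < (u m : ℝ) ^ aIdx u m := by positivity
  have h1 : 0 ≤ ∑ k, ((c k : ℕ) : ℝ) / (u m : ℝ) ^ (aIdx u m + 1 + (k : ℕ)) :=
    Finset.sum_nonneg fun _ _ => by positivity
  have h2 := digit_sum_le (by omega) hq (aIdx u m) _ c
  have h3 : y ≤ eta u m y := by
    rw [eta, le_div_iff₀ hs]
    exact Nat.le_ceil _
  have h4 : eta u m y ≤ y + 1 / (u m : ℝ) ^ aIdx u m := by
    rw [eta, div_le_iff₀ hs, add_mul, one_div_mul_cancel hs.ne']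
    exact (Nat.ceil_lt_add_one (by positivity)).le
  have h5 : 1 / (u m : ℝ) ^ aIdx u m ≤ Real.exp (-angle u m) := by
    rw [Real.exp_neg, ← one_div]
    exact one_div_le_one_div_of_le (Real.exp_pos _) (exp_angle_le_pow u m hu)
  rw [sigmaPoint]
  constructor <;> linarith

theorem two_mul_exp_neg_angle_succ_le {u : ℕ → ℕ} (hu : 1 ≤ u 1) {m : ℕ} (hm : 1 ≤ m) :
    2 * Real.exp (-angle u (m + 1)) ≤ Real.exp (-angle u m) := by
  have hm' : (1 : ℝ) ≤ m := by exact_mod_cast hm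
  have h := angle_add_sq_le hu hm
  have h1 : (2 : ℝ) ≤ Real.exp 1 := by have := Real.exp_one_gt_d9; linarith
  calc 2 * Real.exp (-angle u (m + 1)) ≤ Real.exp 1 * Real.exp (-angle u (m + 1)) := by gcongr
    _ = Real.exp (1 + -angle u (m + 1)) := by rw [Real.exp_add]
    _ ≤ _ := by
      rw [Real.exp_le_exp]
      nlinarith

theorem exists_limit {u : ℕ → ℕ} (hu : 1 ≤ u 1) {ξ : ℕ → ℝ} (h0 : ξ 0 = 0)
    (hstep : ∀ m, 0 ≤ ξ m → ξ m ≤ ξ (m + 1) ∧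
      ξ (m + 1) ≤ ξ m + 2 * Real.exp (-angle u (m + 1))) :
    ∃ x, Filter.Tendsto ξ Filter.atTop (nhds x) ∧
      ∀ m, ξ m ≤ x ∧ x ≤ ξ m + 4 * Real.exp (-angle u (m + 1)) := by
  have hnn : ∀ m, 0 ≤ ξ m := fun m => by
    induction m with
    | zero => exact h0.ge
    | succ m ih => exact ih.trans (hstep m ih).1
  have hmono : Monotone ξ := monotone_nat_of_le_succ fun m => (hstep m (hnn m)).1
  -- The subtracted term makes the induction close: as the exponentials at least halve at each step,
  -- it pays for the next increment.
  have hle : ∀ m k, ξ (m + k) ≤ ξ m + 4 * Real.exp (-angle u (m + 1)) -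
      4 * Real.exp (-angle u (m + k + 1)) := fun m k => by
    induction k with
    | zero => simp
    | succ k ih =>
      have h1 := (hstep (m + k) (hnn _)).2
      have h2 := two_mul_exp_neg_angle_succ_le hu (m := m + k + 1) (by omega)
      rw [← add_assoc]
      linarith
  have hle' : ∀ m k, ξ k ≤ ξ m + 4 * Real.exp (-angle u (m + 1)) := fun m k => by
    have h1 := hle m k
    have h2 := hmono (Nat.le_add_left k m)
    have := Real.exp_pos (-(angle u (m + k + 1) : ℝ))
    linarith
  have hbdd : BddAbove (Set.range ξ) :=
    ⟨_, by rintro _ ⟨k, rfl⟩; exact hle' 0 k⟩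
  refine ⟨_, tendsto_atTop_ciSup hmono hbdd, fun m => ⟨le_ciSup hbdd m, ciSup_le (hle' m)⟩⟩

/-! ### Bounds for `A` -/

theorem card_frequencies_le {m : ℕ} (hm : 1 ≤ m) :
    (((Finset.Icc (-(m : ℤ)) m).filter fun t => t ≠ 0).card : ℝ) ≤ 3 * m := by
  have h1 := Finset.card_filter_le (Finset.Icc (-(m : ℤ)) m) fun t => t ≠ 0
  rw [Int.card_Icc] at h1
  exact_mod_cast (by omega : ((Finset.Icc (-(m : ℤ)) m).filter fun t => t ≠ 0).card ≤ 3 * m)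

theorem sum_sum_le_mul {m : ℕ} (hm : 1 ≤ m) (P : ℕ → Prop) [DecidablePred P] {f : ℤ → ℕ → ℝ}
    {B : ℝ} (hB : 0 ≤ B)
    (h : ∀ t : ℤ, t ≠ 0 → t.natAbs ≤ m → ∀ k, 1 ≤ k → k ≤ m → P k → f t k ≤ B) :
    ∑ t ∈ (Finset.Icc (-(m : ℤ)) m).filter (fun t => t ≠ 0),
      ∑ k ∈ (Finset.Icc 1 m).filter P, f t k ≤ 3 * (m : ℝ) ^ 2 * B := by
  have h1 : ∀ t ∈ (Finset.Icc (-(m : ℤ)) m).filter (fun t => t ≠ 0),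
      ∑ k ∈ (Finset.Icc 1 m).filter P, f t k ≤ m * B := by
    intro t ht
    simp only [Finset.mem_filter, Finset.mem_Icc] at ht
    refine (Finset.sum_le_card_nsmul _ _ B fun k hk => ?_).trans ?_
    · simp only [Finset.mem_filter, Finset.mem_Icc] at hk
      exact h t ht.2 (by omega) k hk.1.1 hk.1.2 hk.2
    · rw [nsmul_eq_mul]
      refine mul_le_mul_of_nonneg_right ?_ hB
      exact_mod_cast (Finset.card_filter_le _ _).trans (by simp)
  refine (Finset.sum_le_card_nsmul _ _ _ h1).trans ?_
  rw [nsmul_eq_mul]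
  calc _ ≤ 3 * (m : ℝ) * (m * B) :=
        mul_le_mul_of_nonneg_right (card_frequencies_le hm) (by positivity)
    _ = _ := by ring

theorem sum_pow_le {r : ℕ} (hr : 2 ≤ r) (A B : ℕ) :
    ∑ j ∈ Finset.Icc (A + 1) B, (r : ℝ) ^ (j - 1) ≤ 2 * ((r : ℝ) ^ B / r) := by
  have hr' : (2 : ℝ) ≤ r := by exact_mod_cast hr
  have h1 : ∑ j ∈ Finset.Icc (A + 1) B, (r : ℝ) ^ (j - 1) ≤ ∑ x ∈ Finset.range B, (r : ℝ) ^ x := by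
    have h2 := sum_Icc_succ_eq_sum_range (fun j => (r : ℝ) ^ j) 0 B
    simp only [zero_add, Nat.sub_zero] at h2
    rw [← h2]
    refine Finset.sum_le_sum_of_subset_of_nonneg ?_ fun _ _ _ => by positivity
    exact Finset.Icc_subset_Icc (by omega) le_rfl
  have h3 := geom_sum_mul (r : ℝ) B
  have h4 : 0 ≤ ∑ x ∈ Finset.range B, (r : ℝ) ^ x := Finset.sum_nonneg fun _ _ => by positivity
  rw [← mul_div_assoc, le_div_iff₀ (by linarith)]
  nlinarith

/-- The powers `r ^ (j - 1)` sum to at most `2 e ^ ⟨m + 1⟩`, which cancels the distance `4 e ^ (-⟨m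
+ 1⟩)`. What remains is `2 · 32 m`, with `2 π` bounded by 8. -/
theorem norm_sum_sub_le {u : ℕ → ℕ} {m r : ℕ} (hr : 2 ≤ r) {t : ℤ} (ht : t.natAbs ≤ m) {x z : ℝ}
    (hxz : |x - z| ≤ 4 * Real.exp (-angle u (m + 1))) :
    ‖∑ j ∈ Finset.Icc (angleBase u m r + 1) (angleBase u (m + 1) r), e ((r : ℝ) ^ (j - 1) * t * x) -
      ∑ j ∈ Finset.Icc (angleBase u m r + 1) (angleBase u (m + 1) r),
        e ((r : ℝ) ^ (j - 1) * t * z)‖ ≤ 64 * m := by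
  have hr' : (2 : ℝ) ≤ r := by exact_mod_cast hr
  have ht' : |(t : ℝ)| ≤ m := by
    rw [← Int.cast_abs, Int.abs_eq_natAbs]
    exact_mod_cast ht
  rw [← Finset.sum_sub_distrib]
  have h1 : ∀ j ∈ Finset.Icc (angleBase u m r + 1) (angleBase u (m + 1) r),
      ‖e ((r : ℝ) ^ (j - 1) * t * x) - e ((r : ℝ) ^ (j - 1) * t * z)‖ ≤
        (r : ℝ) ^ (j - 1) * (32 * m * Real.exp (-angle u (m + 1))) := by
    intro j _
    refine (norm_e_sub_e_le _ _).trans ?_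
    rw [← mul_sub, abs_mul, abs_mul, abs_of_pos (by positivity : (0 : ℝ) < (r : ℝ) ^ (j - 1))]
    calc 2 * Real.pi * ((r : ℝ) ^ (j - 1) * |(t : ℝ)| * |x - z|)
        ≤ 2 * 4 * ((r : ℝ) ^ (j - 1) * m * (4 * Real.exp (-angle u (m + 1)))) := by
          gcongr
          exact Real.pi_lt_four.le
      _ = _ := by ring
  refine (norm_sum_le_of_le _ h1).trans ?_
  rw [← Finset.sum_mul]
  have h2 := sum_pow_le hr (angleBase u m r) (angleBase u (m + 1) r)
  have h3 : (r : ℝ) ^ angleBase u (m + 1) r / r ≤ Real.exp (angle u (m + 1)) := by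
    rw [div_le_iff₀ (by linarith), mul_comm]
    exact pow_angleBase_le u (m + 1) hr
  calc _ ≤ 2 * Real.exp (angle u (m + 1)) * (32 * m * Real.exp (-angle u (m + 1))) :=
        mul_le_mul_of_nonneg_right (by linarith) (by positivity)
    _ = 64 * m * (Real.exp (angle u (m + 1)) * Real.exp (-angle u (m + 1))) := by ring
    _ = _ := by rw [← Real.exp_add, add_neg_cancel, Real.exp_zero, mul_one]

theorem A_le_two_mul_A_add {u : ℕ → ℕ} {m : ℕ} (hm : 1 ≤ m) (hu : ∀ k, 1 ≤ k → 2 ≤ u k) {x z : ℝ}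
    (hxz : |x - z| ≤ 4 * Real.exp (-angle u (m + 1))) :
    A u m x ≤ 2 * A u m z + 3 * (m : ℝ) ^ 2 * (2 * (64 * m) ^ 2) := by
  classical
  rw [← sub_le_iff_le_add', A, A, Finset.mul_sum, ← Finset.sum_sub_distrib]
  simp only [Finset.mul_sum, ← Finset.sum_sub_distrib]
  have h := sum_sum_le_mul hm (fun k => ¬ BaseEquiv (u k) (u m)) (B := 2 * (64 * (m : ℝ)) ^ 2)
    (f := fun t k =>
      ‖∑ j ∈ Finset.Icc (angleBase u m (u k) + 1) (angleBase u (m + 1) (u k)),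
        e ((u k : ℝ) ^ (j - 1) * t * x)‖ ^ 2 -
      2 * ‖∑ j ∈ Finset.Icc (angleBase u m (u k) + 1) (angleBase u (m + 1) (u k)),
        e ((u k : ℝ) ^ (j - 1) * t * z)‖ ^ 2) (by positivity) ?_
  · convert h
  · intro t _ htm k hk1 _ _
    have h1 := norm_sum_sub_le (hu k hk1) htm hxz
    have h2 := norm_sub_norm_le
      (∑ j ∈ Finset.Icc (angleBase u m (u k) + 1) (angleBase u (m + 1) (u k)),
        e ((u k : ℝ) ^ (j - 1) * t * x))
      (∑ j ∈ Finset.Icc (angleBase u m (u k) + 1) (angleBase u (m + 1) (u k)),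
        e ((u k : ℝ) ^ (j - 1) * t * z))
    set X := ‖∑ j ∈ Finset.Icc (angleBase u m (u k) + 1) (angleBase u (m + 1) (u k)),
        e ((u k : ℝ) ^ (j - 1) * t * x)‖
    set Z := ‖∑ j ∈ Finset.Icc (angleBase u m (u k) + 1) (angleBase u (m + 1) (u k)),
        e ((u k : ℝ) ^ (j - 1) * t * z)‖
    have hX : 0 ≤ X := norm_nonneg _
    have h3 : X ≤ Z + 64 * m := by linarith
    have h4 : X ^ 2 ≤ (Z + 64 * m) ^ 2 := pow_le_pow_left₀ hX h3 2
    have := sq_nonneg (Z - 64 * m)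
    change X ^ 2 - 2 * Z ^ 2 ≤ _
    linarith

/-- Differences of exponents below `cutoff u m`, and exponents within this distance of the upper
end, are estimated trivially. -/
def cutoff (u : ℕ → ℕ) (m : ℕ) : ℕ := 3 * m + 2 * u 1 + 2

theorem le_two_pow_cutoff {u : ℕ → ℕ} {m t : ℕ} (hum : u m ≤ u 1 * m) (ht : t ≤ m) :
    4 * t * u m ^ 2 ≤ 2 ^ cutoff u m := by
  have h1 : u 1 ≤ 2 ^ u 1 := Nat.lt_two_pow_self.le
  have h2 : m ≤ 2 ^ m := Nat.lt_two_pow_self.le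
  -- From `n ≤ 2 ^ n` the exponent is `2 + m + 2 (u 1 + m)`, which is the cutoff.
  calc 4 * t * u m ^ 2 ≤ 4 * 2 ^ m * (2 ^ u 1 * 2 ^ m) ^ 2 := by
        gcongr
        · exact ht.trans h2
        · exact hum.trans (Nat.mul_le_mul h1 h2)
    _ = 2 ^ cutoff u m := by
        rw [cutoff]
        ring

theorem pow_aIdx_le (u : ℕ → ℕ) (m : ℕ) {r : ℕ} (hr : 2 ≤ r) (hu : 2 ≤ u m) :
    u m ^ aIdx u m ≤ u m * r ^ angleBase u m r := by
  have h : (u m : ℝ) ^ aIdx u m ≤ u m * (r : ℝ) ^ angleBase u m r :=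
    (pow_angleBase_le u m hu).trans
      (mul_le_mul_of_nonneg_left (exp_angle_le_pow u m hr) (Nat.cast_nonneg _))
  exact_mod_cast h

theorem pow_angleBase_le_mul_pow_bIdx (u : ℕ → ℕ) (m : ℕ) {r : ℕ} (hr : 2 ≤ r) (hu : 2 ≤ u m) :
    r ^ angleBase u (m + 1) r ≤ r * u m ^ bIdx u m := by
  have h : (r : ℝ) ^ angleBase u (m + 1) r ≤ r * (u m : ℝ) ^ bIdx u m :=
    (pow_angleBase_le u (m + 1) hr).trans
      (mul_le_mul_of_nonneg_left (exp_angle_le_pow u (m + 1) hu) (Nat.cast_nonneg _))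
  exact_mod_cast h

theorem length_bound_le {u : ℕ → ℕ} {m : ℕ} (hm : 1 ≤ m) (hu : 1 ≤ u 1) {r : ℕ} (hr : 2 ≤ r)
    {β D : ℝ} (hD : D = (angle u (m + 1) : ℝ) - angle u m) (hβ0 : 0 ≤ β) (hβ : β ≤ 1 / 2) :
    4 * cutoff u m * ((angleBase u (m + 1) r - angleBase u m r : ℕ) : ℝ) +
      8 * ((angleBase u (m + 1) r - angleBase u m r : ℕ) : ℝ) *
        ((angleBase u (m + 1) r - angleBase u m r : ℕ) : ℝ) ^ (1 - β) ≤
      (132 + 24 * u 1) * D ^ (2 - β) := by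
  have hm' : (1 : ℝ) ≤ m := by exact_mod_cast hm
  have hsq := angle_add_sq_le hu hm
  have hDm : (m : ℝ) ^ 2 ≤ D := by rw [hD]; linarith
  have hD1 : 1 ≤ D := by nlinarith
  have hR := angleBase_sub_le hu hm hr
  rw [← hD] at hR
  set R : ℝ := ((angleBase u (m + 1) r - angleBase u m r : ℕ) : ℝ)
  have hR0 : 0 ≤ R := Nat.cast_nonneg _
  have hDpow : D ^ (2 - β) = D * D ^ (1 - β) := by
    rw [show 2 - β = 1 + (1 - β) by ring, Real.rpow_add (by linarith), Real.rpow_one]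
  -- This is where `β ≤ 1/2` matters: the trivially estimated terms, of order `m D`, stay below `D ^
  -- (2 - β)`.
  have hmD : (m : ℝ) ≤ D ^ (1 - β) := by
    calc (m : ℝ) = Real.sqrt ((m : ℝ) ^ 2) := (Real.sqrt_sq (by linarith)).symm
      _ ≤ Real.sqrt D := Real.sqrt_le_sqrt hDm
      _ = D ^ (1 / 2 : ℝ) := Real.sqrt_eq_rpow D
      _ ≤ D ^ (1 - β) := Real.rpow_le_rpow_of_exponent_le hD1 (by linarith)
  have hRpow : R ^ (1 - β) ≤ 3 * D ^ (1 - β) := by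
    calc R ^ (1 - β) ≤ (3 * D) ^ (1 - β) := Real.rpow_le_rpow hR0 hR (by linarith)
      _ = 3 ^ (1 - β) * D ^ (1 - β) := Real.mul_rpow (by norm_num) (by linarith)
      _ ≤ 3 ^ (1 : ℝ) * D ^ (1 - β) := by
          gcongr
          · norm_num
          · linarith
      _ = _ := by rw [Real.rpow_one]
  have hcut : (cutoff u m : ℝ) ≤ (5 + 2 * u 1) * m := by
    rw [cutoff]
    push_cast
    have : (0 : ℝ) ≤ u 1 := Nat.cast_nonneg _
    nlinarith
  have h1 : 4 * cutoff u m * R ≤ 4 * ((5 + 2 * u 1) * D ^ (1 - β)) * (3 * D) := by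
    gcongr
    exact hcut.trans (mul_le_mul_of_nonneg_left hmD (by positivity))
  have h2 : 8 * R * R ^ (1 - β) ≤ 8 * (3 * D) * (3 * D ^ (1 - β)) := by gcongr
  rw [hDpow]
  linarith

theorem IsMinimalChoice.A_le {p u : ℕ → ℕ} {C : ℕ → ℝ} {N : ℕ → ℕ∞} {m q : ℕ} {y x : ℝ}
    (h : IsMinimalChoice u C N m y q x) (hm : 1 ≤ m) (hu : ∀ k, 1 ≤ k → 2 ≤ u k)
    (hum : u m ≤ u 1 * m) (hN : leastThreshold q (C q) (1 / 2) ≤ N q) (hq : q ≠ 0) (hqu : q ≤ u m)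
    (hsine : ∀ k, 1 ≤ k → k ≤ m → ¬ BaseEquiv (u k) (u m) →
      SineBound (fun _ => q) (u k) (u m) (beta p u m)) :
    A u m x ≤ 6 * (m : ℝ) ^ 2 * ((132 + 24 * u 1) *
      ((angle u (m + 1) : ℝ) - angle u m) ^ (2 - beta p u m)) := by
  classical
  have hA := h.A_mul_le hN
  set n := bIdx u m - aIdx u m - 2 with hn
  set D := (angle u (m + 1) : ℝ) - angle u m with hD
  have hu1 : 1 ≤ u 1 := (hu 1 le_rfl).trans' one_le_two
  have hD0 : 0 ≤ D := by
    have := angle_add_sq_le hu1 hm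
    have := sq_nonneg (m : ℝ)
    rw [hD]
    linarith
  have hqn : (0 : ℝ) < (q : ℝ) ^ n := by
    have : (0 : ℝ) < q := by exact_mod_cast Nat.pos_of_ne_zero hq
    positivity
  have hsum : ∑ c, A u m (sigmaPoint u m y q c) ≤ 3 * (m : ℝ) ^ 2 *
      ((q : ℝ) ^ n * ((132 + 24 * u 1) * D ^ (2 - beta p u m))) := by
    simp only [A]
    rw [Finset.sum_comm]
    simp only [Finset.sum_comm (s := (Finset.univ : Finset (Fin _ → Fin q)))]
    have := sum_sum_le_mul hm (fun k => ¬ BaseEquiv (u k) (u m))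
      (B := (q : ℝ) ^ n * ((132 + 24 * u 1) * D ^ (2 - beta p u m)))
      (f := fun t k => ∑ c, ‖∑ j ∈ Finset.Icc (angleBase u m (u k) + 1) (angleBase u (m + 1) (u k)),
        e ((u k : ℝ) ^ (j - 1) * t * sigmaPoint u m y q c)‖ ^ 2) (by positivity) ?_
    · convert this
    · intro t ht htm k hk1 hkm hk
      have hum2 := hu m hm
      refine (mean_square_le (eta u m y) hq hqu hum2 (hu k hk1) (beta_le_half p u m)
        (hsine k hk1 hkm hk) ht (pow_aIdx_le u m (hu k hk1) hum2) ?_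
        (le_two_pow_cutoff hum htm)).trans ?_
      -- The exponent `a + 2 + n` covers `b_m` even under truncated subtraction; the 2 accounts for
      -- the two positions left without digits.
      · refine (pow_angleBase_le_mul_pow_bIdx u m (hu k hk1) hum2).trans ?_
        gcongr
        · omega
        · omega
      · exact mul_le_mul_of_nonneg_left (length_bound_le hm hu1 (hu k hk1) hD
          (beta_nonneg p u m) (beta_le_half p u m)) hqn.le
  refine le_of_mul_le_mul_left ?_ hqn
  linarith

end SchmidtConstruction

open SchmidtConstruction

theorem mainTheorem3 (u₁ : ℕ) :
    ∃ δ : ℝ, ∀ (p u : ℕ → ℕ) (C : ℕ → ℝ) (N : ℕ → ℕ∞) (ξ : ℕ → ℝ),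
      u 1 = u₁ →
      (∀ m : ℕ, 1 ≤ m → 2 ≤ u m) →
      (∀ m : ℕ, 1 ≤ m → 1 ≤ p (u m) ∧ p (u m) ≤ u m) →
      (∀ b : ℕ, SchmidtConstruction.leastThreshold b (C b) (1 / 2) ≤ N b) →
      SchmidtConstruction.IsGoodSequence p N u →
      ξ 0 = 0 →
      (∀ m : ℕ, 1 ≤ m →
        SchmidtConstruction.Criterion1 p u C N m (ξ (m - 1)) (ξ m) ∨
        SchmidtConstruction.Criterion2 u C N m (ξ (m - 1)) (ξ m)) →
      ∃ x : ℝ, Filter.Tendsto ξ Filter.atTop (nhds x) ∧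
        ∀ m : ℕ, 1 ≤ m →
          SchmidtConstruction.A u m x ≤
            δ * (m : ℝ) ^ 2 *
              ((SchmidtConstruction.angle u (m + 1) : ℝ) - SchmidtConstruction.angle u m) ^
                (2 - SchmidtConstruction.beta p u m) := by
  -- Passing from `ξ m` to the limit doubles the 6 of `IsMinimalChoice.A_le`. The error term is `3 ·
  -- 2 · 64 ^ 2 = 24576` times `m ^ 4`, and `m ^ 2 ≤ D ^ (2 - β)`.
  refine ⟨12 * (132 + 24 * u₁) + 24576, fun p u C N ξ h1 hu hp hN hgood h0 hξ => ?_⟩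
  have hu1 : 1 ≤ u 1 := (hu 1 le_rfl).trans' one_le_two
  obtain ⟨x, hlim, hx⟩ := exists_limit hu1 h0 fun m hm => by
    rcases hξ (m + 1) (by omega) with h | h
    · exact IsMinimalChoice.mem_Icc h (hu _ (by omega)) (hp _ (by omega)).2 hm
    · exact IsMinimalChoice.mem_Icc h (hu _ (by omega)) le_rfl hm
  refine ⟨x, hlim, fun m hm => ?_⟩
  have hA : A u m (ξ m) ≤ 6 * (m : ℝ) ^ 2 * ((132 + 24 * u 1) *
      ((angle u (m + 1) : ℝ) - angle u m) ^ (2 - beta p u m)) := by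
    rcases hξ m hm with h | h
    · exact IsMinimalChoice.A_le h hm hu (hgood.le_mul m hm) (hN _)
        (Nat.one_le_iff_ne_zero.1 (hp m hm).1) (hp m hm).2
        -- `SineBound p r s` uses `p` only at `s`, so the constant function with value `p (u m)`
        -- gives the same statement by definition.
        fun k hk1 hkm hk => sineBound_beta p u hk1 hkm hk
    · exact IsMinimalChoice.A_le h hm hu (hgood.le_mul m hm) (hN _)
        (by have := hu m hm; omega) le_rfl
        fun k hk1 _ _ => sineBound_full (hu k hk1) (hu m hm) (beta_le_half p u m)
  have hxm : |x - ξ m| ≤ 4 * Real.exp (-angle u (m + 1)) := by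
    rw [abs_of_nonneg (by linarith [(hx m).1])]
    linarith [(hx m).2]
  have hclose := A_le_two_mul_A_add hm hu hxm
  set D := (angle u (m + 1) : ℝ) - angle u m with hD
  have hm' : (1 : ℝ) ≤ m := by exact_mod_cast hm
  have hDm : (m : ℝ) ^ 2 ≤ D := by linarith [angle_add_sq_le hu1 hm]
  have hD1 : 1 ≤ D := by nlinarith
  have hDpow : (m : ℝ) ^ 2 ≤ D ^ (2 - beta p u m) := by
    refine hDm.trans ?_
    conv_lhs => rw [← Real.rpow_one D]
    exact Real.rpow_le_rpow_of_exponent_le hD1 (by linarith [beta_le_half p u m])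
  have h2 : (m : ℝ) ^ 2 * (m : ℝ) ^ 2 ≤ (m : ℝ) ^ 2 * D ^ (2 - beta p u m) :=
    mul_le_mul_of_nonneg_left hDpow (by positivity)
  rw [← h1]
  linarith
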